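/- Let $d$ be a natural number, let $G:\mathbb R^d\to\mathbb R^d$ be of class $C^2$ with $G(0)=0$, and consider the ODE $V'=G(V)$. Let $V^c\subset\mathbb R^d$ be the center subspace of the Jacobian matrix $DG(0)$, i.e. the set of real vectors lying in the sum of the complex generalized eigenspaces $\{v\in\mathbb C^d:\ [DG(0)-\lambda I]^k v=0 \text{ for some } k\le d\}$ over the eigenvalues $\lambda$ with $\operatorname{Re}\lambda=0$. Assume $V^c\neq\{0\}$. Write $B(0,\delta)$ for the open Euclidean ball of radius $\delta$ centered at $0$. Then there exist $\delta>0$, a set $\mathcal M^c\subset\mathbb R^d$ and a map $\phi_c: B(0,\delta)\cap V^c\to\mathbb R^d$ such that: (1) $\mathcal M^c$ is a continuously differentiable (embedded) submanifold parametrized by $\phi_c$: $\mathcal M^c=\phi_c(B(0,\delta)\cap V^c)$, and $\phi_c$ is of class $C^1$, has injective differential at every point, and is a homeomorphism onto its image. Moreover $\mathcal M^c$ is tangent to $V^c$ at the origin: $\phi_c(0)=0$ and the range of $D\phi_c(0)$ is $V^c$. (2) $\mathcal M^c$ is locally invariant: for every $V_0\in\mathcal M^c$ the Cauchy problem $V'=G(V)$,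 $V(0)=V_0$ has a solution on a neighborhood of $t=0$, and for every such solution $V(t)\in\mathcal M^c$ whenever $|t|$ is small enough (depending on $V_0$ and on the solution). (3) If $V:\mathbb R\to\mathbb R^d$ is a solution of $V'=G(V)$ with $V(t)\in B(0,\delta)$ for every $t\in\mathbb R$, then $V(t)\in\mathcal M^c$ for every $t\in\mathbb R$. -/

import Mathlib

open Topology

/-- The Jacobian matrix of `G` at `x` in the standard coordinates. -/
noncomputable def jacobianMatrix {d : ℕ}
    (G : EuclideanSpace ℝ (Fin d) → EuclideanSpace ℝ (Fin d)) (x : EuclideanSpace ℝ (Fin d)) :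
    Matrix (Fin d) (Fin d) ℝ :=
  Matrix.of fun i j => (fderiv ℝ G x (EuclideanSpace.single j 1)) i

/-- The inclusion of `ℝ^d` into `ℂ^d`, as a real linear map. -/
noncomputable def complexify (d : ℕ) : EuclideanSpace ℝ (Fin d) →ₗ[ℝ] (Fin d → ℂ) where
  toFun v := fun i => (v i : ℂ)
  map_add' v w := by
    funext i
    simp
  map_smul' c v := by
    funext i
    simp

/-- The sum, in `ℂ^d`, of the generalized eigenspaces
`{v | (A - μ I)^k v = 0 for some k}` over all complex `μ` with zero real part
(only eigenvalues `μ` contribute, and `k ≤ d` always suffices). -/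
noncomputable def complexCenterSubspace {d : ℕ} (A : Matrix (Fin d) (Fin d) ℝ) :
    Submodule ℂ (Fin d → ℂ) :=
  ⨆ (μ : ℂ) (_ : μ.re = 0),
    Module.End.maxGenEigenspace (Matrix.toLin' (A.map (fun r : ℝ => (r : ℂ)))) μ

/-- The center subspace of a real matrix: the real vectors in the sum of the complex generalized
eigenspaces associated with the eigenvalues with zero real part. -/
noncomputable def centerSubspace {d : ℕ} (A : Matrix (Fin d) (Fin d) ℝ) :
    Submodule ℝ (EuclideanSpace ℝ (Fin d)) :=
  ((complexCenterSubspace A).restrictScalars ℝ).comap (complexify d)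

/-- `M` is a continuously differentiable (embedded) submanifold of `ℝ^d`, parametrized by `φ` over
the open ball of radius `δ` about the origin of the subspace `U`: the image of the ball under `φ`
is `M`, and on the ball `φ` is a `C¹` immersion and a homeomorphism onto its image.
The values of `φ` outside the ball play no role. -/
structure IsC1Parametrization {d : ℕ} (U : Submodule ℝ (EuclideanSpace ℝ (Fin d))) (δ : ℝ)
    (φ : U → EuclideanSpace ℝ (Fin d)) (M : Set (EuclideanSpace ℝ (Fin d))) : Prop where
  image_eq : φ '' Metric.ball 0 δ = M
  contDiffOn : ContDiffOn ℝ 1 φ (Metric.ball 0 δ)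
  immersion : ∀ x ∈ Metric.ball (0 : U) δ, Function.Injective (fderiv ℝ φ x)
  isEmbedding : IsEmbedding (fun x : Metric.ball (0 : U) δ => φ x)

/-- The parametrization `φ` sends the origin to the origin and the tangent space there, that is the
range of the derivative of `φ` at the origin, is `U`. -/
def IsTangentAtOrigin {d : ℕ} (U : Submodule ℝ (EuclideanSpace ℝ (Fin d)))
    (φ : U → EuclideanSpace ℝ (Fin d)) : Prop :=
  φ 0 = 0 ∧ LinearMap.range (fderiv ℝ φ 0 : U →ₗ[ℝ] EuclideanSpace ℝ (Fin d)) = U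

/-- `V` solves the Cauchy problem `V' = G(V)`, `V(0) = V₀` on some neighbourhood of `t = 0`. -/
def IsLocalSolution {d : ℕ} (G : EuclideanSpace ℝ (Fin d) → EuclideanSpace ℝ (Fin d))
    (V₀ : EuclideanSpace ℝ (Fin d)) (V : ℝ → EuclideanSpace ℝ (Fin d)) : Prop :=
  V 0 = V₀ ∧ IsIntegralCurveAt V (fun _ => G) 0

/-- Local invariance of `M` for `V' = G(V)`: for every `V₀` in `M` the Cauchy problem with
`V(0) = V₀` is solvable near `t = 0`, and its solution lies in `M` for all small `|t|`. -/
def IsLocallyInvariant {d : ℕ} (G : EuclideanSpace ℝ (Fin d) → EuclideanSpace ℝ (Fin d))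
    (M : Set (EuclideanSpace ℝ (Fin d))) : Prop :=
  ∀ V₀ ∈ M, (∃ V, IsLocalSolution G V₀ V) ∧
    ∀ V, IsLocalSolution G V₀ V → ∃ ε > 0, ∀ t : ℝ, |t| < ε → V t ∈ M

/-! The proof is the Lyapunov–Perron method. Put `A = DG(0)`. On the center subspace `exp (t • A)`
grows more slowly than any exponential; on the stable and unstable subspaces it decays like `exp (-β
|t|)` in positive and negative time respectively (`nonempty_centerSplitting`).

Fix a rate `0 < κ < β` and call a global function slow if it is `O(exp (κ |t|))`. For slow forcing
`r`, the equation `R' = A R + r` has exactly one slow solution with a prescribed center component at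
time `0`: slowness forces the stable part of `R 0` to be an integral over the past and the unstable
part an integral over the future. This gives solvability and an a priori estimate
(`CenterSplitting.exists_weightedSolvable`).

Near the origin `G` equals `A + g`, where a cutoff makes the derivative of `g` globally small and
Lipschitz (`exists_cutoff`). Smallness turns the linear theory into a contraction, so each `ξ` in
the center subspace is the center component at time `0` of exactly one slow solution `V` of `V' = A
V + g V` (`WeightedSolvable.exists_slowSolution`). Set `Φ ξ = V 0`. Time translates of slow
solutions are slow, so the image of `Φ` is invariant; bounded solutions are slow, so they lie in it.

For the `C¹` regularity (`SlowData.exists_centerMap`), the candidate derivative solves the equation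
linearized along `V`. The errors are quadratic in functions of growth `exp (η |t|)`, hence of growth
`exp (2 η |t|)`; the linear theory is therefore needed at both rates `η` and `2 η`, both below `β`.
Restricting `Φ` to a small, suitably rescaled ball gives the local statement for `G`. -/

/-- The sum of the generalized eigenspaces of `f` over the eigenvalues in `Λ`. -/
noncomputable def spectralSubspace {F : Type*} [AddCommGroup F] [Module ℂ F]
    (f : Module.End ℂ F) (Λ : Set ℂ) : Submodule ℂ F :=
  ⨆ (μ : ℂ) (_ : μ ∈ Λ), f.maxGenEigenspace μ

/-! ### Spectral subspaces and projections over `ℂ`. -/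

section Complex

variable {F : Type*} [AddCommGroup F] [Module ℂ F]

theorem maxGenEigenspace_le_spectralSubspace (f : Module.End ℂ F) {Λ : Set ℂ} {μ : ℂ}
    (h : μ ∈ Λ) : f.maxGenEigenspace μ ≤ spectralSubspace f Λ :=
  le_iSup₂_of_le μ h le_rfl

theorem isCompl_spectralSubspace [FiniteDimensional ℂ F] (f : Module.End ℂ F) (Λ : Set ℂ) :
    IsCompl (spectralSubspace f Λ) (spectralSubspace f Λᶜ) := by
  refine IsCompl.of_le ?_ ?_
  · exact ((Module.End.independent_maxGenEigenspace f).disjoint_biSup_biSup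
      (disjoint_compl_right (a := Λ))).le_bot
  · rw [← Module.End.iSup_maxGenEigenspace_eq_top f]
    refine iSup_le fun μ => ?_
    by_cases h : μ ∈ Λ
    · exact (maxGenEigenspace_le_spectralSubspace f h).trans le_sup_left
    · exact (maxGenEigenspace_le_spectralSubspace f (Λ := Λᶜ) h).trans le_sup_right

/-- The projection onto the generalized eigenspaces for `Λ` along the other ones. -/
noncomputable def spectralProjection [FiniteDimensional ℂ F] (f : Module.End ℂ F) (Λ : Set ℂ) :
    Module.End ℂ F :=
  (spectralSubspace f Λ).projection _ (isCompl_spectralSubspace f Λ)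

variable [FiniteDimensional ℂ F] (f : Module.End ℂ F) (Λ : Set ℂ)

theorem spectralProjection_mem (v : F) : spectralProjection f Λ v ∈ spectralSubspace f Λ :=
  Submodule.projection_apply_mem _ _

variable {Λ}

theorem spectralProjection_of_mem {v : F} (hv : v ∈ spectralSubspace f Λ) :
    spectralProjection f Λ v = v :=
  Submodule.projection_apply_of_mem_left _ hv

theorem spectralProjection_of_disjoint {Λ' : Set ℂ} (h : Disjoint Λ Λ') {v : F}
    (hv : v ∈ spectralSubspace f Λ') : spectralProjection f Λ v = 0 := by
  refine (Submodule.projection_apply_eq_zero_iff (isCompl_spectralSubspace f Λ)).2 ?_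
  exact (show spectralSubspace f Λ' ≤ spectralSubspace f Λᶜ from
    biSup_mono fun μ hμ => Set.disjoint_right.1 h hμ) hv

/-- Over `ℂ` the generalized eigenspaces span, so identities between spectral projections can be
checked on one of them at a time, where each projection is `0` or the identity. -/
theorem linearMap_ext_maxGenEigenspace {M : Type*} [AddCommGroup M] [Module ℂ M]
    {g h : F →ₗ[ℂ] M} (H : ∀ μ, ∀ v ∈ f.maxGenEigenspace μ, g v = h v) : g = h := by
  have : (⊤ : Submodule ℂ F) ≤ LinearMap.eqLocus g h := by
    rw [← Module.End.iSup_maxGenEigenspace_eq_top f]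
    exact iSup_le fun μ v hv => H μ v hv
  ext v
  exact this (Submodule.mem_top (x := v))

theorem spectralProjection_eigen {μ : ℂ} {v : F} (hv : v ∈ f.maxGenEigenspace μ) :
    (μ ∈ Λ → spectralProjection f Λ v = v) ∧ (μ ∉ Λ → spectralProjection f Λ v = 0) :=
  ⟨fun h => spectralProjection_of_mem f (maxGenEigenspace_le_spectralSubspace f h hv),
    fun h => spectralProjection_of_disjoint f (disjoint_compl_right (a := Λ))
      (maxGenEigenspace_le_spectralSubspace f (Λ := Λᶜ) h hv)⟩

variable (Λ)

theorem spectralProjection_comm (v : F) :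
    spectralProjection f Λ (f v) = f (spectralProjection f Λ v) := by
  have : spectralProjection f Λ ∘ₗ f = f ∘ₗ spectralProjection f Λ := by
    refine linearMap_ext_maxGenEigenspace f fun μ v hv => ?_
    have hfv : f v ∈ f.maxGenEigenspace μ :=
      Module.End.mapsTo_maxGenEigenspace_of_comm (Commute.refl f) μ hv
    have h1 := spectralProjection_eigen (Λ := Λ) f hv
    have h2 := spectralProjection_eigen (Λ := Λ) f hfv
    by_cases h : μ ∈ Λ
    · simp [h1.1 h, h2.1 h]
    · simp [h1.2 h, h2.2 h]
  exact LinearMap.congr_fun this v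

theorem spectralProjection_add_add {Λ₁ Λ₂ Λ₃ : Set ℂ} (h12 : Disjoint Λ₁ Λ₂) (h13 : Disjoint Λ₁ Λ₃)
    (h23 : Disjoint Λ₂ Λ₃) (hu : ∀ μ, μ ∈ Λ₁ ∨ μ ∈ Λ₂ ∨ μ ∈ Λ₃) (v : F) :
    spectralProjection f Λ₁ v + spectralProjection f Λ₂ v + spectralProjection f Λ₃ v = v := by
  have : spectralProjection f Λ₁ + spectralProjection f Λ₂ + spectralProjection f Λ₃
      = LinearMap.id := by
    refine linearMap_ext_maxGenEigenspace f fun μ v hv => ?_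
    have h1 := spectralProjection_eigen (Λ := Λ₁) f hv
    have h2 := spectralProjection_eigen (Λ := Λ₂) f hv
    have h3 := spectralProjection_eigen (Λ := Λ₃) f hv
    rw [Set.disjoint_left] at h12 h13 h23
    rcases hu μ with h | h | h
    · simp [h1.1 h, h2.2 (h12 h), h3.2 (h13 h)]
    · simp [h1.2 (fun h' => h12 h' h), h2.1 h, h3.2 (h23 h)]
    · simp [h1.2 (fun h' => h13 h' h), h2.2 (fun h' => h23 h' h), h3.1 h]
  exact LinearMap.congr_fun this v

end Complex

/-! ### Growth of the exponential on generalized eigenspaces. -/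

section Growth

variable {F : Type*} [NormedAddCommGroup F] [NormedSpace ℂ F] [CompleteSpace F]

theorem exp_smul_apply_of_pow_eq_zero (N : F →L[ℂ] F) {v : F} {k : ℕ} (h : (N ^ k) v = 0) (t : ℂ) :
    NormedSpace.exp (t • N) v = ∑ n ∈ Finset.range k, ((n.factorial : ℂ)⁻¹ * t ^ n) • (N ^ n) v := by
  have h1 := (NormedSpace.exp_series_hasSum_exp' (𝕂 := ℂ) (t • N)).mapL
    (ContinuousLinearMap.apply ℂ F v)
  refine h1.unique ?_
  have h2 : ∀ n, (ContinuousLinearMap.apply ℂ F v) ((n.factorial : ℂ)⁻¹ • (t • N) ^ n)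
      = ((n.factorial : ℂ)⁻¹ * t ^ n) • (N ^ n) v := by
    intro n
    simp [smul_pow, mul_smul]
  simp only [h2]
  refine hasSum_sum_of_ne_finset_zero fun n hn => ?_
  obtain ⟨m, rfl⟩ := Nat.exists_eq_add_of_le (not_lt.1 (fun h => hn (Finset.mem_range.2 h)))
  have h3 : (N ^ (k + m)) v = 0 := by
    rw [add_comm, pow_add, mul_apply_eq_comp, h, map_zero]
  rw [h3, smul_zero]

theorem exp_smul_eq_exp_mul_exp_sub (B : F →L[ℂ] F) (μ t : ℂ) (v : F) :
    NormedSpace.exp (t • B) v = Complex.exp (t * μ) • NormedSpace.exp (t • (B - μ • 1)) v := by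
  have h1 : t • B = (t * μ) • (1 : F →L[ℂ] F) + t • (B - μ • 1) := by
    rw [smul_sub, smul_smul]; abel
  have h2 : NormedSpace.exp ((t * μ) • (1 : F →L[ℂ] F)) = Complex.exp (t * μ) • 1 := by
    rw [← Algebra.algebraMap_eq_smul_one, ← Algebra.algebraMap_eq_smul_one,
      Complex.exp_eq_exp_ℂ, ← NormedSpace.algebraMap_exp_comm]
  let _ : NormedAlgebra ℚ (F →L[ℂ] F) := NormedAlgebra.restrictScalars ℚ ℂ _
  rw [h1, NormedSpace.exp_add_of_commute, h2]
  · simp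
  · exact (Commute.one_left _).smul_left _

/-- On a generalized eigenvector the exponential is `exp (t μ)` times a polynomial in `t`, and `(ε
|t|) ^ n / n! ≤ exp (ε |t|)` absorbs each monomial. -/
theorem exists_bound_exp_of_mem_maxGenEigenspace (B : F →L[ℂ] F) {μ : ℂ} {v : F}
    (hv : v ∈ Module.End.maxGenEigenspace (B : F →ₗ[ℂ] F) μ) {ε : ℝ} (hε : 0 < ε) :
    ∃ C : ℝ, ∀ t : ℝ, ‖NormedSpace.exp ((t : ℂ) • B) v‖ ≤ C * Real.exp (t * μ.re + ε * |t|) := by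
  obtain ⟨k, hk⟩ := (Module.End.mem_maxGenEigenspace _ _ _).1 hv
  set N : F →L[ℂ] F := B - μ • 1 with hN
  have hNc : ∀ n, ∀ w, (N ^ n) w = (((B : F →ₗ[ℂ] F) - μ • 1) ^ n) w := by
    intro n
    induction n with
    | zero => intro w; simp
    | succ n ih => intro w; rw [pow_succ, pow_succ, mul_apply_eq_comp, ih]; simp [hN]
  have hNk : (N ^ k) v = 0 := by rw [hNc, hk]
  refine ⟨∑ n ∈ Finset.range k, (ε ^ n)⁻¹ * ‖(N ^ n) v‖, fun t => ?_⟩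
  have h1 : ((t : ℂ) * μ).re = t * μ.re := by simp
  have h2 : ‖∑ n ∈ Finset.range k, ((n.factorial : ℂ)⁻¹ * (t : ℂ) ^ n) • (N ^ n) v‖
      ≤ ∑ n ∈ Finset.range k, (ε ^ n)⁻¹ * ‖(N ^ n) v‖ * Real.exp (ε * |t|) := by
    refine norm_sum_le_of_le _ fun n _ => ?_
    have h3 := Real.pow_div_factorial_le_exp (x := ε * |t|) (by positivity) n
    rw [norm_smul, mul_right_comm]
    gcongr
    rw [norm_mul, norm_inv, norm_pow, Complex.norm_real, Complex.norm_natCast, Real.norm_eq_abs,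
      inv_mul_eq_div, inv_mul_eq_div, le_div_iff₀ (by positivity)]
    calc |t| ^ n / n.factorial * ε ^ n = (ε * |t|) ^ n / n.factorial := by rw [mul_pow]; ring
      _ ≤ _ := h3
  rw [exp_smul_eq_exp_mul_exp_sub B μ, exp_smul_apply_of_pow_eq_zero _ hNk, norm_smul,
    Complex.norm_exp, Real.exp_add, h1, mul_comm (Real.exp _), mul_comm (Real.exp _), ← mul_assoc,
    Finset.sum_mul]
  gcongr

end Growth

/-- Used with `J` the coordinatewise real part, to carry growth bounds from the complexified matrix
to the real operator. -/
theorem map_exp_apply_of_intertwining {X Y : Type*} [NormedAddCommGroup X] [NormedSpace ℂ X]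
    [CompleteSpace X] [NormedAddCommGroup Y] [NormedSpace ℝ Y] [CompleteSpace Y]
    (J : X →L[ℝ] Y) (B : X →L[ℂ] X) (A : Y →L[ℝ] Y) (h : ∀ v, J (B v) = A (J v)) (t : ℝ) (v : X) :
    J (NormedSpace.exp ((t : ℂ) • B) v) = NormedSpace.exp (t • A) (J v) := by
  have hpow : ∀ n : ℕ, ∀ v, J ((B ^ n) v) = (A ^ n) (J v) := by
    intro n
    induction n with
    | zero => intro v; simp
    | succ n ih =>
      intro v
      rw [pow_succ, pow_succ, mul_apply_eq_comp, mul_apply_eq_comp, ih, h]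
  have h1 := ((NormedSpace.exp_series_hasSum_exp' (𝕂 := ℂ) ((t : ℂ) • B)).mapL
    (ContinuousLinearMap.apply ℂ X v)).mapL J
  have h2 := (NormedSpace.exp_series_hasSum_exp' (𝕂 := ℝ) (t • A)).mapL
    (ContinuousLinearMap.apply ℝ Y (J v))
  refine h1.unique (h2.congr_fun ?_)
  intro n
  have h3 : ∀ w : X, ((n.factorial : ℂ)⁻¹ * (t : ℂ) ^ n) • w = ((n.factorial : ℝ)⁻¹ * t ^ n) • w := by
    intro w
    rw [← Complex.coe_smul]; push_cast; rfl
  simp only [ContinuousLinearMap.apply_apply, smul_pow, smul_smul, smul_apply]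
  rw [h3, map_smul, hpow]

/-! ### Real spectral projections and their exponential bounds. -/

section RealProjection

variable {d : ℕ}

/-- The complex matrix of a real matrix, acting on `ℂ^d`. -/
noncomputable def complexEnd (M : Matrix (Fin d) (Fin d) ℝ) : Module.End ℂ (Fin d → ℂ) :=
  Matrix.toLin' (M.map (fun r : ℝ => (r : ℂ)))

/-- The coordinatewise real part. -/
noncomputable def coordRe (d : ℕ) : (Fin d → ℂ) →ₗ[ℝ] EuclideanSpace ℝ (Fin d) where
  toFun z := WithLp.toLp 2 fun i => (z i).re
  map_add' z w := by ext i; simp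
  map_smul' c z := by ext i; simp

theorem coordRe_complexify (v : EuclideanSpace ℝ (Fin d)) : coordRe d (complexify d v) = v := by
  ext i; simp [coordRe, complexify]

theorem complexify_coordRe (z : Fin d → ℂ) :
    complexify d (coordRe d z) = (2⁻¹ : ℂ) • (z + star z) := by
  funext i
  simp [coordRe, complexify, Complex.add_conj]

theorem star_complexEnd (M : Matrix (Fin d) (Fin d) ℝ) (z : Fin d → ℂ) :
    star (complexEnd M z) = complexEnd M (star z) := by
  funext i
  simp [complexEnd, Matrix.mulVec, dotProduct]

theorem star_mem_maxGenEigenspace (M : Matrix (Fin d) (Fin d) ℝ) {μ : ℂ} {z : Fin d → ℂ}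
    (hz : z ∈ (complexEnd M).maxGenEigenspace μ) :
    star z ∈ (complexEnd M).maxGenEigenspace (star μ) := by
  obtain ⟨k, hk⟩ := (Module.End.mem_maxGenEigenspace _ _ _).1 hz
  refine (Module.End.mem_maxGenEigenspace _ _ _).2 ⟨k, ?_⟩
  have key : ∀ n : ℕ, ∀ w, star (((complexEnd M - μ • 1) ^ n) w)
      = ((complexEnd M - star μ • 1) ^ n) (star w) := by
    intro n
    induction n with
    | zero => intro w; simp
    | succ n ih =>
      intro w
      rw [pow_succ, pow_succ, Module.End.mul_apply, Module.End.mul_apply, ih]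
      simp [star_complexEnd]
  rw [← key, hk, star_zero]

/-- A real matrix commutes with conjugation, which therefore swaps the generalized eigenspaces of
`μ` and its conjugate. This is why real parts of vectors of the subspace stay in it. -/
theorem star_mem_spectralSubspace (M : Matrix (Fin d) (Fin d) ℝ) {Λ : Set ℂ}
    (hΛ : ∀ μ ∈ Λ, star μ ∈ Λ) {z : Fin d → ℂ} (hz : z ∈ spectralSubspace (complexEnd M) Λ) :
    star z ∈ spectralSubspace (complexEnd M) Λ := by
  have : spectralSubspace (complexEnd M) Λ ≤ (spectralSubspace (complexEnd M) Λ).comap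
      (starLinearEquiv ℂ : (Fin d → ℂ) ≃ₗ⋆[ℂ] (Fin d → ℂ)).toLinearMap :=
    iSup₂_le fun μ hμ w hw => maxGenEigenspace_le_spectralSubspace _ (hΛ μ hμ)
      (star_mem_maxGenEigenspace M hw)
  exact this hz

theorem complexify_coordRe_mem (M : Matrix (Fin d) (Fin d) ℝ) {Λ : Set ℂ}
    (hΛ : ∀ μ ∈ Λ, star μ ∈ Λ) {z : Fin d → ℂ} (hz : z ∈ spectralSubspace (complexEnd M) Λ) :
    complexify d (coordRe d z) ∈ spectralSubspace (complexEnd M) Λ := by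
  rw [complexify_coordRe]
  exact Submodule.smul_mem _ _ (Submodule.add_mem _ hz (star_mem_spectralSubspace M hΛ hz))

/-- The real spectral projection of a real matrix for a set `Λ` of complex numbers, meant for
sets invariant under conjugation. -/
noncomputable def realProjection (M : Matrix (Fin d) (Fin d) ℝ) (Λ : Set ℂ) :
    EuclideanSpace ℝ (Fin d) →L[ℝ] EuclideanSpace ℝ (Fin d) :=
  LinearMap.toContinuousLinearMap
    (coordRe d ∘ₗ (spectralProjection (complexEnd M) Λ).restrictScalars ℝ ∘ₗ complexify d)

theorem realProjection_apply (M : Matrix (Fin d) (Fin d) ℝ) (Λ : Set ℂ)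
    (v : EuclideanSpace ℝ (Fin d)) :
    realProjection M Λ v = coordRe d (spectralProjection (complexEnd M) Λ (complexify d v)) :=
  rfl

variable (M : Matrix (Fin d) (Fin d) ℝ)

theorem complexify_realProjection_mem {Λ : Set ℂ} (hΛ : ∀ μ ∈ Λ, star μ ∈ Λ)
    (v : EuclideanSpace ℝ (Fin d)) :
    complexify d (realProjection M Λ v) ∈ spectralSubspace (complexEnd M) Λ :=
  complexify_coordRe_mem M hΛ (spectralProjection_mem _ _ _)

theorem realProjection_of_mem {Λ : Set ℂ} {v : EuclideanSpace ℝ (Fin d)}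
    (hv : complexify d v ∈ spectralSubspace (complexEnd M) Λ) : realProjection M Λ v = v := by
  rw [realProjection_apply, spectralProjection_of_mem _ hv, coordRe_complexify]

theorem realProjection_of_disjoint {Λ Λ' : Set ℂ} (h : Disjoint Λ Λ') (hΛ' : ∀ μ ∈ Λ', star μ ∈ Λ')
    (v : EuclideanSpace ℝ (Fin d)) : realProjection M Λ (realProjection M Λ' v) = 0 := by
  rw [realProjection_apply, spectralProjection_of_disjoint _ h
    (complexify_realProjection_mem M hΛ' v), map_zero]

theorem realProjection_comm {A : EuclideanSpace ℝ (Fin d) →L[ℝ] EuclideanSpace ℝ (Fin d)}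
    (hA : ∀ v, complexify d (A v) = complexEnd M (complexify d v))
    (hA' : ∀ z, coordRe d (complexEnd M z) = A (coordRe d z)) (Λ : Set ℂ)
    (v : EuclideanSpace ℝ (Fin d)) : realProjection M Λ (A v) = A (realProjection M Λ v) := by
  rw [realProjection_apply, hA, spectralProjection_comm, hA', realProjection_apply]

theorem exists_bound_exp_of_mem_spectralSubspace {F : Type*} [NormedAddCommGroup F]
    [NormedSpace ℂ F] [CompleteSpace F] (B : F →L[ℂ] F) {Λ : Set ℂ} {s : Set ℝ} {ω : ℝ → ℝ} {ε : ℝ}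
    (hε : 0 < ε) (h : ∀ μ ∈ Λ, Module.End.HasEigenvalue (B : F →ₗ[ℂ] F) μ →
      ∀ t ∈ s, t * μ.re + ε * |t| ≤ ω t) {z : F}
    (hz : z ∈ spectralSubspace (B : F →ₗ[ℂ] F) Λ) :
    ∃ C : ℝ, ∀ t ∈ s, ‖NormedSpace.exp ((t : ℂ) • B) z‖ ≤ C * Real.exp (ω t) := by
  -- The vectors obeying such a bound, with a constant depending on the vector, form a subspace, so
  -- it suffices to treat generalized eigenvectors; a nonzero one makes `μ` an eigenvalue.
  let W : Submodule ℂ F :=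
    { carrier := {z | ∃ C : ℝ, ∀ t ∈ s, ‖NormedSpace.exp ((t : ℂ) • B) z‖ ≤ C * Real.exp (ω t)}
      zero_mem' := ⟨0, fun t _ => by simp⟩
      add_mem' := by
        rintro a b ⟨C, hC⟩ ⟨C', hC'⟩
        refine ⟨C + C', fun t ht => ?_⟩
        rw [map_add, add_mul]
        exact (norm_add_le _ _).trans (add_le_add (hC t ht) (hC' t ht))
      smul_mem' := by
        rintro c a ⟨C, hC⟩
        refine ⟨‖c‖ * C, fun t ht => ?_⟩
        rw [map_smul, norm_smul, mul_assoc]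
        exact mul_le_mul_of_nonneg_left (hC t ht) (norm_nonneg _) }
  have hW : spectralSubspace (B : F →ₗ[ℂ] F) Λ ≤ W := by
    refine iSup₂_le fun μ hμ v hv => ?_
    by_cases h0 : v = 0
    · rw [h0]; exact W.zero_mem
    have hev : Module.End.HasEigenvalue (B : F →ₗ[ℂ] F) μ := by
      obtain ⟨k, hk⟩ := (Module.End.mem_maxGenEigenspace _ _ _).1 hv
      refine Module.End.hasEigenvalue_of_hasGenEigenvalue (k := k) ?_
      refine fun hbot => h0 ?_
      have : v ∈ (Module.End.genEigenspace (B : F →ₗ[ℂ] F) μ) k :=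
        Module.End.mem_genEigenspace_nat.2 hk
      simpa [hbot] using this
    obtain ⟨C, hC⟩ := exists_bound_exp_of_mem_maxGenEigenspace B hv hε
    have hC0 : 0 ≤ C := by
      have := (norm_nonneg _).trans (hC 0)
      simpa using this
    refine ⟨C, fun t ht => (hC t).trans ?_⟩
    have := h μ hμ hev t ht
    gcongr
  exact hW hz

theorem exists_bound_exp_realProjection
    {A : EuclideanSpace ℝ (Fin d) →L[ℝ] EuclideanSpace ℝ (Fin d)}
    (hA' : ∀ z, coordRe d (complexEnd M z) = A (coordRe d z)) {Λ : Set ℂ} {s : Set ℝ}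
    {ω : ℝ → ℝ} {ε : ℝ} (hε : 0 < ε) (h : ∀ μ ∈ Λ, (complexEnd M).HasEigenvalue μ →
      ∀ t ∈ s, t * μ.re + ε * |t| ≤ ω t) :
    ∃ C : ℝ, 0 ≤ C ∧ ∀ t ∈ s, ∀ v,
      ‖NormedSpace.exp (t • A) (realProjection M Λ v)‖ ≤ C * Real.exp (ω t) * ‖v‖ := by
  set B : (Fin d → ℂ) →L[ℂ] (Fin d → ℂ) := LinearMap.toContinuousLinearMap (complexEnd M) with hB
  have hBM : (B : (Fin d → ℂ) →ₗ[ℂ] (Fin d → ℂ)) = complexEnd M := rfl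
  set J := LinearMap.toContinuousLinearMap (coordRe d) with hJ
  have hexp := map_exp_apply_of_intertwining J B A hA'
  -- The bounds so far have constants depending on the vector; uniform boundedness of the rescaled
  -- operators replaces them by one constant.
  obtain ⟨C, hC⟩ := banach_steinhaus (σ₁₂ := RingHom.id ℝ)
    (g := fun t : s => Real.exp (-ω t) • (NormedSpace.exp ((t : ℝ) • A) ∘L realProjection M Λ)) (by
      intro v
      obtain ⟨C, hC⟩ := exists_bound_exp_of_mem_spectralSubspace B (Λ := Λ) hε h
        (spectralProjection_mem (complexEnd M) Λ (complexify d v))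
      refine ⟨‖J‖ * C, fun t => ?_⟩
      have h1 := hexp t (spectralProjection (complexEnd M) Λ (complexify d v))
      have h2 : NormedSpace.exp ((t : ℝ) • A) (realProjection M Λ v) = _ := h1.symm
      rw [smul_apply, ContinuousLinearMap.comp_apply, h2, norm_smul, Real.norm_eq_abs,
        Real.abs_exp]
      calc Real.exp (-ω t) * _ ≤ Real.exp (-ω t) * (‖J‖ * (C * Real.exp (ω t))) := by
            gcongr
            exact (J.le_opNorm _).trans (mul_le_mul_of_nonneg_left (hC t t.2) (norm_nonneg _))
        _ = ‖J‖ * C * (Real.exp (-ω t) * Real.exp (ω t)) := by ring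
        _ = ‖J‖ * C := by rw [← Real.exp_add]; simp)
  refine ⟨max C 0, le_max_right _ _, fun t ht v => ?_⟩
  have h1 := ((Real.exp (-ω t) • (NormedSpace.exp (t • A) ∘L realProjection M Λ)).le_opNorm v).trans
    (mul_le_mul_of_nonneg_right ((hC ⟨t, ht⟩).trans (le_max_left C 0)) (norm_nonneg v))
  rw [smul_apply, norm_smul, Real.norm_eq_abs, Real.abs_exp, Real.exp_neg,
    inv_mul_le_iff₀ (Real.exp_pos _)] at h1
  calc _ ≤ _ := h1
    _ = _ := by ring

end RealProjection

/-! ### Center, stable and unstable splitting. -/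

/-- A splitting of the identity into three projections which commute with `A`: the first one onto
`U`, where `exp (t • A)` grows subexponentially, the others such that `exp (t • A)` decays
exponentially on their ranges in positive, respectively negative, time. -/
structure CenterSplitting {E : Type*} [NormedAddCommGroup E] [NormedSpace ℝ E] (A : E →L[ℝ] E)
    (U : Submodule ℝ E) where
  (Pc Ps Pu : E →L[ℝ] E)
  add_add : ∀ v, Pc v + Ps v + Pu v = v
  comm_center : Commute A Pc
  comm_stable : Commute A Ps
  comm_unstable : Commute A Pu
  center_mem : ∀ v, Pc v ∈ U
  center_of_mem : ∀ v ∈ U, Pc v = v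
  center_stable : ∀ v, Pc (Ps v) = 0
  center_unstable : ∀ v, Pc (Pu v) = 0
  stable_stable : ∀ v, Ps (Ps v) = Ps v
  unstable_unstable : ∀ v, Pu (Pu v) = Pu v
  center_bound : ∀ ε > 0, ∃ C : ℝ, 0 ≤ C ∧ ∀ t v,
    ‖NormedSpace.exp (t • A) (Pc v)‖ ≤ C * Real.exp (ε * |t|) * ‖v‖
  (β C : ℝ)
  β_pos : 0 < β
  C_nonneg : 0 ≤ C
  stable_bound : ∀ t : ℝ, 0 ≤ t → ∀ v,
    ‖NormedSpace.exp (t • A) (Ps v)‖ ≤ C * Real.exp (-β * t) * ‖v‖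
  unstable_bound : ∀ t : ℝ, 0 ≤ t → ∀ v,
    ‖NormedSpace.exp (t • -A) (Pu v)‖ ≤ C * Real.exp (-β * t) * ‖v‖

theorem nonempty_centerSplitting {d : ℕ} (M : Matrix (Fin d) (Fin d) ℝ)
    {A : EuclideanSpace ℝ (Fin d) →L[ℝ] EuclideanSpace ℝ (Fin d)}
    (hA : ∀ v i, A v i = ∑ j, M i j * v j) : Nonempty (CenterSplitting A (centerSubspace M)) := by
  have hA1 : ∀ v, complexify d (A v) = complexEnd M (complexify d v) := by
    intro v; funext i
    simp [complexify, hA, complexEnd, Matrix.mulVec, dotProduct]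
  have hA2 : ∀ z, coordRe d (complexEnd M z) = A (coordRe d z) := by
    intro z; ext i
    simp [hA, coordRe, complexEnd, Matrix.mulVec, dotProduct]
  set Λc : Set ℂ := {μ | μ.re = 0}
  set Λs : Set ℂ := {μ | μ.re < 0}
  set Λu : Set ℂ := {μ | 0 < μ.re}
  have hc : ∀ μ ∈ Λc, star μ ∈ Λc := fun μ hμ => by simpa [Λc] using hμ
  have hs : ∀ μ ∈ Λs, star μ ∈ Λs := fun μ hμ => by simpa [Λs] using hμ
  have hu : ∀ μ ∈ Λu, star μ ∈ Λu := fun μ hμ => by simpa [Λu] using hμ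
  have hcs : Disjoint Λc Λs := Set.disjoint_left.2 fun μ (h1 : μ.re = 0) (h2 : μ.re < 0) => by
    linarith
  have hcu : Disjoint Λc Λu := Set.disjoint_left.2 fun μ (h1 : μ.re = 0) (h2 : 0 < μ.re) => by
    linarith
  have hsu : Disjoint Λs Λu := Set.disjoint_left.2 fun μ (h1 : μ.re < 0) (h2 : 0 < μ.re) => by
    linarith
  have hall : ∀ μ : ℂ, μ ∈ Λc ∨ μ ∈ Λs ∨ μ ∈ Λu := fun μ => by
    rcases lt_trichotomy μ.re 0 with h | h | h
    exacts [Or.inr (Or.inl h), Or.inl h, Or.inr (Or.inr h)]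
  -- There are finitely many eigenvalues, hence a spectral gap. The factor `2` leaves a margin `β`
  -- to absorb the polynomial factors.
  obtain ⟨β, hβ0, hβ⟩ : ∃ β : ℝ, 0 < β ∧ ∀ μ, (complexEnd M).HasEigenvalue μ → μ.re ≠ 0 →
      2 * β < |μ.re| := by
    have hfin : {μ | (complexEnd M).HasEigenvalue μ}.Finite := Module.End.finite_hasEigenvalue _
    have h1 : ∀ᶠ β : ℝ in 𝓝[>] 0, ∀ μ ∈ {μ | (complexEnd M).HasEigenvalue μ}, μ.re ≠ 0 →
        2 * β < |μ.re| := by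
      refine (Filter.eventually_all_finite hfin).2 fun μ _ => ?_
      by_cases h0 : μ.re = 0
      · simp [h0]
      · have : ∀ᶠ β : ℝ in 𝓝[>] 0, β < |μ.re| / 2 :=
          (eventually_lt_nhds (by positivity)).filter_mono nhdsWithin_le_nhds
        filter_upwards [this] with β hβ _
        linarith
    obtain ⟨β, h2, h3⟩ := (h1.and self_mem_nhdsWithin).exists
    exact ⟨β, h3, h2⟩
  obtain ⟨C1, hC1, hb1⟩ := exists_bound_exp_realProjection M hA2 (Λ := Λs) (s := Set.Ici 0)
    (ω := fun t => -β * t) hβ0 (by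
      intro μ (hμ : μ.re < 0) hev t (ht : 0 ≤ t)
      have := hβ μ hev hμ.ne
      rw [abs_of_neg hμ] at this
      rw [abs_of_nonneg ht]
      nlinarith)
  obtain ⟨C2, hC2, hb2⟩ := exists_bound_exp_realProjection M hA2 (Λ := Λu) (s := Set.Iic 0)
    (ω := fun t => β * t) hβ0 (by
      intro μ (hμ : 0 < μ.re) hev t (ht : t ≤ 0)
      have := hβ μ hev hμ.ne'
      rw [abs_of_pos hμ] at this
      rw [abs_of_nonpos ht]
      nlinarith)
  have hcomm : ∀ Λ, Commute A (realProjection M Λ) := fun Λ => by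
    ext1 v
    exact (realProjection_comm M hA1 hA2 Λ v).symm
  exact ⟨{
    Pc := realProjection M Λc
    Ps := realProjection M Λs
    Pu := realProjection M Λu
    add_add := fun v => by
      simp only [realProjection_apply]
      rw [← map_add, ← map_add, spectralProjection_add_add _ hcs hcu hsu hall, coordRe_complexify]
    comm_center := hcomm _
    comm_stable := hcomm _
    comm_unstable := hcomm _
    center_mem := complexify_realProjection_mem M hc
    center_of_mem := fun v hv => realProjection_of_mem M hv
    center_stable := realProjection_of_disjoint M hcs hs
    center_unstable := realProjection_of_disjoint M hcu hu
    stable_stable := fun v => realProjection_of_mem M (complexify_realProjection_mem M hs v)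
    unstable_unstable := fun v => realProjection_of_mem M (complexify_realProjection_mem M hu v)
    center_bound := fun ε hε => by
      obtain ⟨C, hC, hb⟩ := exists_bound_exp_realProjection M hA2 (Λ := Λc) (s := Set.univ)
        (ω := fun t => ε * |t|) hε (by
          intro μ (hμ : μ.re = 0) _ t _
          simp [hμ])
      exact ⟨C, hC, fun t v => hb t trivial v⟩
    β := β
    C := max C1 C2
    β_pos := hβ0
    C_nonneg := hC1.trans (le_max_left _ _)
    stable_bound := fun t ht v => (hb1 t ht v).trans (by gcongr; exact le_max_left _ _)
    unstable_bound := fun t ht v => by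
      rw [smul_neg, ← neg_smul]
      refine (hb2 (-t) (neg_nonpos.2 ht) v).trans ?_
      rw [mul_neg, neg_mul]
      gcongr
      exact le_max_right _ _ }⟩

/-! ### Variation of constants on the three components. -/

section Semigroup

variable {E : Type*} [NormedAddCommGroup E] [NormedSpace ℝ E] (A : E →L[ℝ] E)

theorem exp_zero_smul_apply (x : E) : NormedSpace.exp ((0 : ℝ) • A) x = x := by
  rw [zero_smul, NormedSpace.exp_zero]; rfl

theorem exp_smul_apply_comm {A Q : E →L[ℝ] E} (h : Commute A Q) (t : ℝ) (x : E) :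
    Q (NormedSpace.exp (t • A) x) = NormedSpace.exp (t • A) (Q x) := by
  let _ : NormedAlgebra ℚ (E →L[ℝ] E) := NormedAlgebra.restrictScalars ℚ ℝ _
  exact (DFunLike.congr_fun (h.smul_left t).exp_left x).symm

theorem integral_exp_reflect (f : ℝ → E) (t : ℝ) :
    ∫ τ in (0 : ℝ)..(-t), NormedSpace.exp (-τ • -A) (f (-τ))
      = -∫ τ in (0 : ℝ)..t, NormedSpace.exp (-τ • A) (f τ) := by
  simp only [smul_neg, ← neg_smul]
  rw [intervalIntegral.integral_comp_neg (fun τ => NormedSpace.exp (-τ • A) (f τ)), neg_neg,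
    neg_zero, intervalIntegral.integral_symm]

variable [CompleteSpace E]

theorem exp_add_smul_apply (s t : ℝ) (x : E) :
    NormedSpace.exp ((s + t) • A) x = NormedSpace.exp (s • A) (NormedSpace.exp (t • A) x) := by
  let _ : NormedAlgebra ℚ (E →L[ℝ] E) := NormedAlgebra.restrictScalars ℚ ℝ _
  rw [add_smul, NormedSpace.exp_add_of_commute]
  · rfl
  · exact ((Commute.refl A).smul_left s).smul_right t

theorem exp_smul_exp_neg_smul_apply (t : ℝ) (x : E) :
    NormedSpace.exp (t • A) (NormedSpace.exp (-t • A) x) = x := by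
  rw [← exp_add_smul_apply, add_neg_cancel, exp_zero_smul_apply]

theorem exp_neg_smul_exp_smul_apply (t : ℝ) (x : E) :
    NormedSpace.exp (-t • A) (NormedSpace.exp (t • A) x) = x := by
  rw [← exp_add_smul_apply, neg_add_cancel, exp_zero_smul_apply]

theorem hasDerivAt_exp_smul_apply {y : ℝ → E} {y' : E} {t : ℝ} (hy : HasDerivAt y y' t) :
    HasDerivAt (fun t : ℝ => NormedSpace.exp (t • A) (y t))
      (A (NormedSpace.exp (t • A) (y t)) + NormedSpace.exp (t • A) y') t :=
  (hasDerivAt_exp_smul_const' A t).clm_apply hy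

theorem continuous_exp_smul : Continuous fun t : ℝ => NormedSpace.exp (t • A) :=
  continuous_iff_continuousAt.2 fun t => (hasDerivAt_exp_smul_const' (𝕂 := ℝ) A t).continuousAt

variable {A}

theorem continuous_exp_neg_smul_apply {f : ℝ → E} (hf : Continuous f) :
    Continuous fun τ : ℝ => NormedSpace.exp (-τ • A) (f τ) :=
  ((continuous_exp_smul A).comp continuous_neg).clm_apply hf

/-- With `x` the integral of `exp (-τ • A) (Q (r τ))` over the past, the variation of constants
formula becomes an integral over `(-∞, t]`, on which `exp ((t - τ) • A)` decays. -/
theorem exists_stable_initial_value {Q : E →L[ℝ] E} (hQ : Commute A Q) (hQQ : ∀ v, Q (Q v) = Q v)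
    {β C κ ρ : ℝ} (hC : 0 ≤ C) (hκ : 0 ≤ κ) (hκβ : κ < β)
    (hb : ∀ t : ℝ, 0 ≤ t → ∀ v, ‖NormedSpace.exp (t • A) (Q v)‖ ≤ C * Real.exp (-β * t) * ‖v‖)
    {r : ℝ → E} (hr : Continuous r) (hrb : ∀ t, ‖r t‖ ≤ ρ * Real.exp (κ * |t|)) :
    ∃ x, Q x = x ∧ ∀ t, ‖NormedSpace.exp (t • A)
      (x + ∫ τ in (0 : ℝ)..t, NormedSpace.exp (-τ • A) (Q (r τ)))‖
        ≤ C / (β - κ) * ρ * Real.exp (κ * |t|) := by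
  set F : ℝ → E := fun τ => NormedSpace.exp (-τ • A) (Q (r τ)) with hF
  have hFc : Continuous F := continuous_exp_neg_smul_apply (Q.continuous.comp hr)
  have hρ : 0 ≤ ρ := by simpa using (norm_nonneg _).trans (hrb 0)
  have hpt : ∀ t τ, τ ≤ t → ‖NormedSpace.exp (t • A) (F τ)‖ ≤
      C * ρ * Real.exp (κ * |t|) * Real.exp (-(β - κ) * t) * Real.exp ((β - κ) * τ) := by
    intro t τ h
    rw [hF, ← exp_add_smul_apply]
    refine (hb _ (by linarith) _).trans ?_
    -- Moving the weight from `τ` to `t` costs `exp (κ (t - τ))`, which the decay `exp (-β (t - τ))`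
    -- dominates since `κ < β`.
    have h1 : |τ| ≤ |t| + (t - τ) := by
      have := abs_sub_abs_le_abs_sub τ t
      rw [abs_sub_comm, abs_of_nonneg (sub_nonneg.2 h)] at this
      linarith
    calc C * Real.exp (-β * (t + -τ)) * ‖r τ‖
        ≤ C * Real.exp (-β * (t + -τ)) * (ρ * Real.exp (κ * (|t| + (t - τ)))) := by
          gcongr
          exact (hrb τ).trans (by gcongr)
      _ = C * ρ * (Real.exp (-β * (t + -τ)) * Real.exp (κ * (|t| + (t - τ)))) := by ring
      _ = _ := by
          rw [mul_assoc (C * ρ * _), mul_assoc (C * ρ), ← Real.exp_add, ← Real.exp_add,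
            ← Real.exp_add]
          congr 2; ring
  have hSint : ∀ t, MeasureTheory.IntegrableOn (fun τ => NormedSpace.exp (t • A) (F τ))
      (Set.Iic t) := by
    intro t
    refine MeasureTheory.Integrable.mono' ((integrableOn_exp_mul_Iic (sub_pos.2 hκβ) t).const_mul
      (C * ρ * Real.exp (κ * |t|) * Real.exp (-(β - κ) * t)))
      ((ContinuousLinearMap.continuous _).comp hFc).aestronglyMeasurable ?_
    filter_upwards [MeasureTheory.ae_restrict_mem measurableSet_Iic] with τ hτ
    exact hpt t τ hτ
  -- The decay estimate controls `F` only after applying `exp (t • A)`; applying the inverse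
  -- operator recovers integrability of `F`.
  have hint : ∀ t, MeasureTheory.IntegrableOn F (Set.Iic t) := by
    intro t
    have := (NormedSpace.exp (-t • A)).integrable_comp (hSint t)
    simp only [exp_neg_smul_exp_smul_apply] at this
    exact this
  refine ⟨∫ τ in Set.Iic 0, F τ, ?_, fun t => ?_⟩
  · rw [← Q.integral_comp_comm (hint 0)]
    congr 1
    ext τ
    rw [hF, exp_smul_apply_comm hQ, hQQ]
  · rw [← intervalIntegral.integral_Iic_sub_Iic (hint 0) (hint t), add_sub_cancel,
      ← ContinuousLinearMap.integral_comp_comm _ (hint t)]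
    refine (MeasureTheory.norm_integral_le_of_norm_le
      ((integrableOn_exp_mul_Iic (sub_pos.2 hκβ) t).const_mul
      (C * ρ * Real.exp (κ * |t|) * Real.exp (-(β - κ) * t))) ?_).trans ?_
    · filter_upwards [MeasureTheory.ae_restrict_mem measurableSet_Iic] with τ hτ
      exact hpt t τ hτ
    · rw [MeasureTheory.integral_const_mul, integral_exp_mul_Iic (sub_pos.2 hκβ)]
      have h2 : Real.exp (-(β - κ) * t) * Real.exp ((β - κ) * t) = 1 := by
        rw [← Real.exp_add, neg_mul, neg_add_cancel, Real.exp_zero]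
      refine le_of_eq ?_
      calc _ = C * ρ * Real.exp (κ * |t|) * (Real.exp (-(β - κ) * t) * Real.exp ((β - κ) * t))
            / (β - κ) := by ring
        _ = _ := by rw [h2]; ring

/-- Time reversal exchanges the unstable part of `A` with the stable part of `-A`. -/
theorem exists_unstable_initial_value {Q : E →L[ℝ] E} (hQ : Commute A Q)
    (hQQ : ∀ v, Q (Q v) = Q v) {β C κ ρ : ℝ} (hC : 0 ≤ C) (hκ : 0 ≤ κ) (hκβ : κ < β)
    (hb : ∀ t : ℝ, 0 ≤ t → ∀ v, ‖NormedSpace.exp (t • -A) (Q v)‖ ≤ C * Real.exp (-β * t) * ‖v‖)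
    {r : ℝ → E} (hr : Continuous r) (hrb : ∀ t, ‖r t‖ ≤ ρ * Real.exp (κ * |t|)) :
    ∃ x, Q x = x ∧ ∀ t, ‖NormedSpace.exp (t • A)
      (x + ∫ τ in (0 : ℝ)..t, NormedSpace.exp (-τ • A) (Q (r τ)))‖
        ≤ C / (β - κ) * ρ * Real.exp (κ * |t|) := by
  obtain ⟨x, hx, h⟩ := exists_stable_initial_value (A := -A) (Q := Q) hQ.neg_left hQQ hC hκ hκβ hb
    (r := fun t => r (-t)) (hr.comp continuous_neg) (fun t => by simpa using hrb (-t))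
  refine ⟨-x, by rw [map_neg, hx], fun t => ?_⟩
  have h1 := h (-t)
  rw [integral_exp_reflect A (fun τ => Q (r τ)), smul_neg, neg_smul, neg_neg, abs_neg] at h1
  rwa [← norm_neg, ← map_neg, neg_add, neg_neg]

theorem norm_exp_smul_integral_le_of_nonneg {Q : E →L[ℝ] E} {ε C κ ρ : ℝ} (hC : 0 ≤ C)
    (hεκ : ε < κ)
    (hb : ∀ (t : ℝ) v, ‖NormedSpace.exp (t • A) (Q v)‖ ≤ C * Real.exp (ε * |t|) * ‖v‖)
    {r : ℝ → E} (hr : Continuous r) (hrb : ∀ t, ‖r t‖ ≤ ρ * Real.exp (κ * |t|)) {t : ℝ}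
    (ht : 0 ≤ t) :
    ‖NormedSpace.exp (t • A) (∫ τ in (0 : ℝ)..t, NormedSpace.exp (-τ • A) (Q (r τ)))‖
        ≤ C / (κ - ε) * ρ * Real.exp (κ * |t|) := by
  have hρ : 0 ≤ ρ := by simpa using (norm_nonneg _).trans (hrb 0)
  have hd : 0 < κ - ε := sub_pos.2 hεκ
  have hFc : Continuous fun τ : ℝ => NormedSpace.exp (-τ • A) (Q (r τ)) :=
    continuous_exp_neg_smul_apply (Q.continuous.comp hr)
  rw [← ContinuousLinearMap.intervalIntegral_comp_comm _ (hFc.intervalIntegrable _ _)]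
  have h1 : ‖∫ τ in (0 : ℝ)..t, NormedSpace.exp (t • A) (NormedSpace.exp (-τ • A) (Q (r τ)))‖ ≤
      ∫ τ in (0 : ℝ)..t, C * ρ * Real.exp (ε * t) * Real.exp ((κ - ε) * τ) := by
    refine intervalIntegral.norm_integral_le_of_norm_le ht (Filter.Eventually.of_forall ?_)
      (Continuous.intervalIntegrable (by fun_prop) _ _)
    intro τ hτ
    rw [← exp_add_smul_apply]
    refine (hb _ _).trans ?_
    have h2 := hrb τ
    rw [abs_of_pos hτ.1] at h2
    rw [abs_of_nonneg (by linarith [hτ.2])]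
    calc C * Real.exp (ε * (t + -τ)) * ‖r τ‖
        ≤ C * Real.exp (ε * (t + -τ)) * (ρ * Real.exp (κ * τ)) := by gcongr
      _ = C * ρ * (Real.exp (ε * (t + -τ)) * Real.exp (κ * τ)) := by ring
      _ = _ := by
        rw [mul_assoc (C * ρ), ← Real.exp_add, ← Real.exp_add]
        congr 2; ring
  refine h1.trans ?_
  have h3 : ∫ τ in (0 : ℝ)..t, Real.exp ((κ - ε) * τ) = (Real.exp ((κ - ε) * t) - 1) / (κ - ε) := by
    rw [intervalIntegral.integral_comp_mul_left (fun x => Real.exp x) hd.ne', integral_exp]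
    simp [inv_mul_eq_div]
  rw [intervalIntegral.integral_const_mul, h3, abs_of_nonneg ht]
  calc _ ≤ C * ρ * Real.exp (ε * t) * (Real.exp ((κ - ε) * t) / (κ - ε)) := by
        gcongr; linarith
    _ = C / (κ - ε) * ρ * (Real.exp (ε * t) * Real.exp ((κ - ε) * t)) := by ring
    _ = _ := by rw [← Real.exp_add]; congr 2; ring

/-- The center component needs no correction of the initial value: its growth rate `ε` is below that
of the forcing, so integrating from `0` preserves the weight. -/
theorem norm_exp_smul_integral_le {Q : E →L[ℝ] E} {ε C κ ρ : ℝ} (hC : 0 ≤ C) (hεκ : ε < κ)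
    (hb : ∀ (t : ℝ) v, ‖NormedSpace.exp (t • A) (Q v)‖ ≤ C * Real.exp (ε * |t|) * ‖v‖)
    {r : ℝ → E} (hr : Continuous r) (hrb : ∀ t, ‖r t‖ ≤ ρ * Real.exp (κ * |t|)) (t : ℝ) :
    ‖NormedSpace.exp (t • A) (∫ τ in (0 : ℝ)..t, NormedSpace.exp (-τ • A) (Q (r τ)))‖
        ≤ C / (κ - ε) * ρ * Real.exp (κ * |t|) := by
  rcases le_total 0 t with ht | ht
  · exact norm_exp_smul_integral_le_of_nonneg hC hεκ hb hr hrb ht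
  · have h := norm_exp_smul_integral_le_of_nonneg (A := -A) (Q := Q) hC hεκ
      (fun t v => by simpa using hb (-t) v)
      (r := fun t => r (-t)) (hr.comp continuous_neg) (fun t => by simpa using hrb (-t))
      (neg_nonneg.2 ht)
    rwa [integral_exp_reflect A (fun τ => Q (r τ)), smul_neg, neg_smul, neg_neg, abs_neg, map_neg,
      norm_neg] at h

end Semigroup

/-! ### Linear theory in exponentially weighted spaces. -/

/-- Solvability and a priori estimate, with constant `K`, of the inhomogeneous linear equation
`R' = A R + r` in the space of functions growing at most like `exp (κ |t|)`, when the component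
`P (R 0) ∈ U` of the initial value is prescribed. -/
structure WeightedSolvable {E : Type*} [NormedAddCommGroup E] [NormedSpace ℝ E] (A P : E →L[ℝ] E)
    (U : Submodule ℝ E) (κ K : ℝ) : Prop where
  exists_solution : ∀ (r : ℝ → E) (ρ : ℝ), Continuous r → (∀ t, ‖r t‖ ≤ ρ * Real.exp (κ * |t|)) →
    ∀ ξ ∈ U, ∃ R : ℝ → E, (∀ t, HasDerivAt R (A (R t) + r t) t) ∧ P (R 0) = ξ ∧
      ∃ M, ∀ t, ‖R t‖ ≤ M * Real.exp (κ * |t|)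
  estimate : ∀ (R r : ℝ → E) (ρ M : ℝ), Continuous r → (∀ t, ‖r t‖ ≤ ρ * Real.exp (κ * |t|)) →
    (∀ t, HasDerivAt R (A (R t) + r t) t) → (∀ t, ‖R t‖ ≤ M * Real.exp (κ * |t|)) →
    ‖R 0 - P (R 0)‖ ≤ K * ρ ∧ ∀ t, ‖R t‖ ≤ K * (‖P (R 0)‖ + ρ) * Real.exp (κ * |t|)

namespace CenterSplitting

variable {E : Type*} [NormedAddCommGroup E] [NormedSpace ℝ E] [CompleteSpace E] {A : E →L[ℝ] E}
  {U : Submodule ℝ E} (D : CenterSplitting A U)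

theorem eq_exp_smul {R : ℝ → E} (hR : ∀ t, HasDerivAt R (A (R t)) t) (t : ℝ) :
    R t = NormedSpace.exp (t • A) (R 0) := by
  have h2 : ∀ t, HasDerivAt (fun t : ℝ => NormedSpace.exp (t • A) (R 0))
      (A (NormedSpace.exp (t • A) (R 0))) t := fun t => by
    simpa using hasDerivAt_exp_smul_apply A (hasDerivAt_const t (R 0))
  refine congr_fun (ODE_solution_unique_univ (v := fun _ => A) (s := fun _ => Set.univ) (t₀ := 0)
    (K := ‖A‖₊)
    (fun _ => A.lipschitz.lipschitzOnWith) (fun t => ⟨hR t, trivial⟩) (fun t => ⟨h2 t, trivial⟩)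
    ?_) t
  simp only [exp_zero_smul_apply]

/-- Flow back by `t` and forward again: the decay `exp (-β t)` on the range of `Q` beats the growth
`exp (κ t)` of the backward orbit. -/
theorem decay_eq_zero {Q : E →L[ℝ] E} (hQ : Commute A Q) {β C κ M : ℝ} (hκβ : κ < β) (hC : 0 ≤ C)
    (hb : ∀ t : ℝ, 0 ≤ t → ∀ v, ‖NormedSpace.exp (t • A) (Q v)‖ ≤ C * Real.exp (-β * t) * ‖v‖)
    {x : E} (hM : ∀ t : ℝ, 0 ≤ t → ‖NormedSpace.exp (-t • A) x‖ ≤ M * Real.exp (κ * t)) :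
    Q x = 0 := by
  have h1 : ∀ t : ℝ, 0 ≤ t → ‖Q x‖ ≤ C * M * Real.exp (-((β - κ) * t)) := by
    intro t ht
    have h2 : Q x = NormedSpace.exp (t • A) (Q (NormedSpace.exp (-t • A) x)) := by
      rw [exp_smul_apply_comm hQ, exp_smul_exp_neg_smul_apply]
    rw [h2]
    refine (hb t ht _).trans ?_
    calc _ ≤ C * Real.exp (-β * t) * (M * Real.exp (κ * t)) := by gcongr; exact hM t ht
      _ = C * M * (Real.exp (-β * t) * Real.exp (κ * t)) := by ring
      _ = _ := by rw [← Real.exp_add]; congr 2; ring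
  have h3 : Filter.Tendsto (fun t : ℝ => C * M * Real.exp (-((β - κ) * t))) Filter.atTop
      (𝓝 (C * M * 0)) :=
    (Real.tendsto_exp_neg_atTop_nhds_zero.comp
      (Filter.tendsto_id.const_mul_atTop (sub_pos.2 hκβ))).const_mul _
  rw [mul_zero] at h3
  have h4 : ‖Q x‖ ≤ 0 := ge_of_tendsto h3
    ((Filter.eventually_ge_atTop 0).mono h1)
  exact norm_le_zero_iff.1 h4

theorem eq_zero_of_growth {κ M : ℝ} (hκβ : κ < D.β) {R : ℝ → E}
    (hR : ∀ t, HasDerivAt R (A (R t)) t) (hM : ∀ t, ‖R t‖ ≤ M * Real.exp (κ * |t|))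
    (h0 : D.Pc (R 0) = 0) (t : ℝ) : R t = 0 := by
  have hs : D.Ps (R 0) = 0 := decay_eq_zero D.comm_stable hκβ D.C_nonneg D.stable_bound
    (M := M) fun t ht => by
      rw [← eq_exp_smul hR]
      simpa [abs_of_nonneg ht] using hM (-t)
  have hu : D.Pu (R 0) = 0 := decay_eq_zero D.comm_unstable.neg_left hκβ D.C_nonneg
    D.unstable_bound (M := M) fun t ht => by
      rw [smul_neg, neg_smul, neg_neg, ← eq_exp_smul hR]
      simpa [abs_of_nonneg ht] using hM t
  rw [eq_exp_smul hR, ← D.add_add (R 0), h0, hs, hu]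
  simp

theorem exists_solution {κ : ℝ} (hκ : 0 < κ) (hκβ : κ < D.β) :
    ∃ K : ℝ, 0 ≤ K ∧ ∀ (r : ℝ → E) (ρ : ℝ), Continuous r →
      (∀ t, ‖r t‖ ≤ ρ * Real.exp (κ * |t|)) → ∀ ξ ∈ U, ∃ R : ℝ → E,
      (∀ t, HasDerivAt R (A (R t) + r t) t) ∧ D.Pc (R 0) = ξ ∧ ‖R 0 - ξ‖ ≤ K * ρ ∧
      ∀ t, ‖R t‖ ≤ K * (‖ξ‖ + ρ) * Real.exp (κ * |t|) := by
  -- Any rate strictly between `0` and `κ` would do; `κ / 2` keeps `κ - ε` positive.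
  obtain ⟨C, hC, hb⟩ := D.center_bound (κ / 2) (by positivity)
  have hd : 0 < D.β - κ := sub_pos.2 hκβ
  have hCβ : 0 ≤ D.C / (D.β - κ) := div_nonneg D.C_nonneg hd.le
  have hCκ : 0 ≤ C / (κ - κ / 2) := div_nonneg hC (by linarith)
  refine ⟨C + C / (κ - κ / 2) + 2 * (D.C / (D.β - κ)), by positivity, ?_⟩
  intro r ρ hr hrb ξ hξ
  have hρ : 0 ≤ ρ := by simpa using (norm_nonneg _).trans (hrb 0)
  obtain ⟨x, hx, hxb⟩ := exists_stable_initial_value D.comm_stable D.stable_stable D.C_nonneg hκ.le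
    hκβ D.stable_bound hr hrb
  obtain ⟨y, hy, hyb⟩ := exists_unstable_initial_value D.comm_unstable D.unstable_unstable
    D.C_nonneg hκ.le hκβ D.unstable_bound hr hrb
  have hcb := norm_exp_smul_integral_le hC (show κ / 2 < κ by linarith) hb hr hrb
  have hcont : Continuous fun τ : ℝ => NormedSpace.exp (-τ • A) (r τ) :=
    continuous_exp_neg_smul_apply hr
  have hcontQ : ∀ (Q : E →L[ℝ] E) (t : ℝ), IntervalIntegrable
      (fun τ : ℝ => NormedSpace.exp (-τ • A) (Q (r τ))) MeasureTheory.volume 0 t := fun Q t =>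
    (continuous_exp_neg_smul_apply (Q.continuous.comp hr)).intervalIntegrable _ _
  have hsplit : ∀ t : ℝ, NormedSpace.exp (t • A) (ξ + x + y +
        ∫ τ in (0 : ℝ)..t, NormedSpace.exp (-τ • A) (r τ))
      = NormedSpace.exp (t • A) ξ +
        NormedSpace.exp (t • A) (∫ τ in (0 : ℝ)..t, NormedSpace.exp (-τ • A) (D.Pc (r τ))) +
        NormedSpace.exp (t • A) (x + ∫ τ in (0 : ℝ)..t, NormedSpace.exp (-τ • A) (D.Ps (r τ))) +
        NormedSpace.exp (t • A) (y + ∫ τ in (0 : ℝ)..t, NormedSpace.exp (-τ • A) (D.Pu (r τ))) := by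
    intro t
    have h1 : ∫ τ in (0 : ℝ)..t, NormedSpace.exp (-τ • A) (r τ) =
        (∫ τ in (0 : ℝ)..t, NormedSpace.exp (-τ • A) (D.Pc (r τ))) +
        (∫ τ in (0 : ℝ)..t, NormedSpace.exp (-τ • A) (D.Ps (r τ))) +
        ∫ τ in (0 : ℝ)..t, NormedSpace.exp (-τ • A) (D.Pu (r τ)) := by
      rw [← intervalIntegral.integral_add (hcontQ _ _) (hcontQ _ _),
        ← intervalIntegral.integral_add ((hcontQ _ _).add (hcontQ _ _)) (hcontQ _ _)]
      congr 1
      ext τ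
      rw [← map_add, ← map_add, D.add_add]
    rw [h1]
    simp only [map_add]
    abel
  refine ⟨fun t => NormedSpace.exp (t • A) (ξ + x + y +
    ∫ τ in (0 : ℝ)..t, NormedSpace.exp (-τ • A) (r τ)), fun t => ?_, ?_, ?_, fun t => ?_⟩
  · have h1 := hasDerivAt_exp_smul_apply A
      ((intervalIntegral.integral_hasDerivAt_right (hcont.intervalIntegrable 0 t)
        (hcont.stronglyMeasurableAtFilter _ _) hcont.continuousAt).const_add (ξ + x + y))
    simpa only [exp_smul_exp_neg_smul_apply] using h1
  · simp only [intervalIntegral.integral_same, add_zero, exp_zero_smul_apply, map_add]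
    rw [← hx, ← hy, D.center_stable, D.center_unstable, D.center_of_mem _ hξ, add_zero, add_zero]
  · have hx0 := hxb 0
    have hy0 := hyb 0
    simp only [intervalIntegral.integral_same, add_zero, exp_zero_smul_apply, abs_zero, mul_zero,
      Real.exp_zero, mul_one] at hx0 hy0 ⊢
    rw [add_assoc, add_sub_cancel_left]
    refine (norm_add_le_of_le hx0 hy0).trans ?_
    have : 0 ≤ (C + C / (κ - κ / 2)) * ρ := by positivity
    nlinarith
  · simp only [hsplit]
    have hξb := hb t ξ
    rw [D.center_of_mem _ hξ] at hξb
    have h1 : Real.exp (κ / 2 * |t|) ≤ Real.exp (κ * |t|) := by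
      gcongr; linarith
    have h2 : ‖NormedSpace.exp (t • A) ξ‖ ≤ C * ‖ξ‖ * Real.exp (κ * |t|) := by
      refine hξb.trans ?_
      rw [mul_right_comm]
      gcongr
    refine (norm_add_le_of_le (norm_add_le_of_le (norm_add_le_of_le h2 (hcb t)) (hxb t))
      (hyb t)).trans ?_
    rw [← add_mul, ← add_mul, ← add_mul]
    gcongr
    have h3 : 0 ≤ (C / (κ - κ / 2) + 2 * (D.C / (D.β - κ))) * ‖ξ‖ := by positivity
    have h4 : 0 ≤ C * ρ := by positivity
    nlinarith

theorem exists_weightedSolvable {κ : ℝ} (hκ : 0 < κ) (hκβ : κ < D.β) :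
    ∃ K : ℝ, 0 ≤ K ∧ WeightedSolvable A D.Pc U κ K := by
  obtain ⟨K, hK, h⟩ := D.exists_solution hκ hκβ
  refine ⟨K, hK, ?_, ?_⟩
  · intro r ρ hr hrb ξ hξ
    obtain ⟨R, h1, h2, -, h4⟩ := h r ρ hr hrb ξ hξ
    exact ⟨R, h1, h2, _, h4⟩
  · intro R r ρ M hr hrb hR hM
    obtain ⟨R', h1, h2, h3, h4⟩ := h r ρ hr hrb _ (D.center_mem (R 0))
    -- The constructed solution satisfies the estimate. The difference from `R` is a slow
    -- homogeneous solution without center component, hence zero, so `R` inherits it.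
    have h5 : ∀ t, R t - R' t = 0 := by
      refine D.eq_zero_of_growth (R := fun t => R t - R' t) (M := M + K * (‖D.Pc (R 0)‖ + ρ)) hκβ
        (fun t => ?_) (fun t => ?_) ?_
      · have := (hR t).sub (h1 t)
        rw [add_sub_add_right_eq_sub, ← map_sub] at this
        exact this
      · rw [add_mul]
        exact (norm_sub_le _ _).trans (add_le_add (hM t) (h4 t))
      · rw [map_sub, h2, sub_self]
    have h6 : ∀ t, R t = R' t := fun t => sub_eq_zero.1 (h5 t)
    exact ⟨by rw [h6 0, h2]; exact h3, fun t => by rw [h6 t]; exact h4 t⟩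

end CenterSplitting

theorem exists_growth_sub {E : Type*} [SeminormedAddCommGroup E] {κ : ℝ} {R₁ R₂ : ℝ → E}
    (h₁ : ∃ M, ∀ t, ‖R₁ t‖ ≤ M * Real.exp (κ * |t|))
    (h₂ : ∃ M, ∀ t, ‖R₂ t‖ ≤ M * Real.exp (κ * |t|)) :
    ∃ M, ∀ t, ‖R₁ t - R₂ t‖ ≤ M * Real.exp (κ * |t|) := by
  obtain ⟨M₁, h₁⟩ := h₁
  obtain ⟨M₂, h₂⟩ := h₂
  refine ⟨M₁ + M₂, fun t => ?_⟩
  rw [add_mul]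
  exact (norm_sub_le _ _).trans (add_le_add (h₁ t) (h₂ t))

/-! ### Slow solutions of the nonlinear equation by contraction. -/

section Nonlinear

variable {E : Type*} [NormedAddCommGroup E] [NormedSpace ℝ E] {A P : E →L[ℝ] E} {U : Submodule ℝ E}
  {κ K ε ρ : ℝ}

theorem WeightedSolvable.norm_le_of_small (H : WeightedSolvable A P U κ K)
    (hε : 0 ≤ ε) (hεK : K * ε ≤ 1 / 2) {R r : ℝ → E} (hr : Continuous r)
    (hR : ∀ t, HasDerivAt R (A (R t) + r t) t) (hM : ∃ M, ∀ t, ‖R t‖ ≤ M * Real.exp (κ * |t|))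
    (hrb : ∀ t, ‖r t‖ ≤ ε * ‖R t‖ + ρ * Real.exp (κ * |t|)) (t : ℝ) :
    ‖R t‖ ≤ 2 * K * (‖P (R 0)‖ + ρ) * Real.exp (κ * |t|) := by
  obtain ⟨M₀, hM₀⟩ := hM
  have hbdd : BddAbove (Set.range fun t => ‖R t‖ / Real.exp (κ * |t|)) := by
    refine ⟨M₀, ?_⟩
    rintro _ ⟨t, rfl⟩
    exact (div_le_iff₀ (Real.exp_pos _)).2 (hM₀ t)
  -- The growth hypothesis serves only to make this best constant finite. The linear estimate bounds
  -- `M` by `K * (‖P (R 0)‖ + ρ) + K * ε * M`, and the last term is absorbed because `K * ε ≤ 1 /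
  -- 2`.
  set M := ⨆ t, ‖R t‖ / Real.exp (κ * |t|) with hMdef
  have hM : ∀ t, ‖R t‖ ≤ M * Real.exp (κ * |t|) := fun t =>
    (div_le_iff₀ (Real.exp_pos _)).1 (le_ciSup hbdd t)
  have hM0 : 0 ≤ M := by simpa using (norm_nonneg _).trans (hM 0)
  have h1 := (H.estimate R r (ε * M + ρ) M hr (fun t => (hrb t).trans (by
    rw [add_mul, mul_assoc]; gcongr; exact hM t)) hR hM).2
  have h2 : M ≤ K * (‖P (R 0)‖ + (ε * M + ρ)) :=
    ciSup_le fun t => (div_le_iff₀ (Real.exp_pos _)).2 (h1 t)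
  have h3 : M ≤ 2 * K * (‖P (R 0)‖ + ρ) := by nlinarith
  exact (hM t).trans (by gcongr)

/-- A global solution of `R' = A R + f t R` which grows at most like `exp (κ |t|)`. -/
structure IsSlowSolution (A : E →L[ℝ] E) (f : ℝ → E → E) (κ : ℝ) (R : ℝ → E) : Prop where
  hasDerivAt : ∀ t, HasDerivAt R (A (R t) + f t (R t)) t
  growth : ∃ M, ∀ t, ‖R t‖ ≤ M * Real.exp (κ * |t|)

theorem IsSlowSolution.continuous {f : ℝ → E → E} {R : ℝ → E} (h : IsSlowSolution A f κ R) :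
    Continuous R :=
  continuous_iff_continuousAt.2 fun t => (h.hasDerivAt t).continuousAt

theorem WeightedSolvable.norm_sub_le (H : WeightedSolvable A P U κ K)
    (hε : 0 ≤ ε) (hεK : K * ε ≤ 1 / 2) {f₁ f₂ : ℝ → E → E} {R₁ R₂ : ℝ → E}
    (hf₁ : Continuous fun t => f₁ t (R₁ t)) (hf₂ : Continuous fun t => f₂ t (R₂ t))
    (h₁ : IsSlowSolution A f₁ κ R₁) (h₂ : IsSlowSolution A f₂ κ R₂)
    (hb : ∀ t, ‖f₁ t (R₁ t) - f₂ t (R₂ t)‖ ≤ ε * ‖R₁ t - R₂ t‖ + ρ * Real.exp (κ * |t|)) (t : ℝ) :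
    ‖R₁ t - R₂ t‖ ≤ 2 * K * (‖P (R₁ 0) - P (R₂ 0)‖ + ρ) * Real.exp (κ * |t|) := by
  rw [← map_sub]
  refine H.norm_le_of_small hε hεK (R := fun t => R₁ t - R₂ t) (hf₁.sub hf₂) (fun t => ?_)
    (exists_growth_sub h₁.growth h₂.growth) hb t
  have := (h₁.hasDerivAt t).sub (h₂.hasDerivAt t)
  rwa [add_sub_add_comm, ← map_sub] at this

theorem WeightedSolvable.slowSolution_unique (H : WeightedSolvable A P U κ K)
    (hε : 0 ≤ ε) (hεK : K * ε ≤ 1 / 2) {f : ℝ → E → E} (hf : Continuous fun p : ℝ × E => f p.1 p.2)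
    (hfε : ∀ t x y, ‖f t x - f t y‖ ≤ ε * ‖x - y‖) {R₁ R₂ : ℝ → E}
    (h₁ : IsSlowSolution A f κ R₁) (h₂ : IsSlowSolution A f κ R₂) (h0 : P (R₁ 0) = P (R₂ 0)) :
    R₁ = R₂ := by
  ext t
  have := H.norm_sub_le hε hεK (ρ := 0) (hf.comp (continuous_id.prodMk h₁.continuous))
    (hf.comp (continuous_id.prodMk h₂.continuous)) h₁ h₂ (fun t => by simpa using hfε t _ _) t
  rw [h0, sub_self, norm_zero, add_zero, mul_zero, zero_mul] at this
  exact sub_eq_zero.1 (norm_le_zero_iff.1 this)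

theorem WeightedSolvable.exists_slowSolution [CompleteSpace E] (H : WeightedSolvable A P U κ K)
    (hε : 0 ≤ ε) (hεK : K * ε ≤ 1 / 2) {f : ℝ → E → E}
    (hf : Continuous fun p : ℝ × E => f p.1 p.2) (hfε : ∀ t x y, ‖f t x - f t y‖ ≤ ε * ‖x - y‖)
    (hf0 : ∀ t, ‖f t 0‖ ≤ ρ * Real.exp (κ * |t|)) {ξ : E} (hξ : ξ ∈ U) :
    ∃ R, IsSlowSolution A f κ R ∧ P (R 0) = ξ := by
  let w : ℝ → ℝ := fun t => Real.exp (κ * |t|)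
  have hw : ∀ t, 0 < w t := fun t => Real.exp_pos _
  have hwc : Continuous w := by fun_prop
  -- Slow functions are written as `w • u` with `u` bounded and continuous, so that the weighted
  -- norm becomes the sup norm on a complete space.
  let r : BoundedContinuousFunction ℝ E → ℝ → E := fun u t => f t (w t • u t)
  have hrc : ∀ u, Continuous (r u) := fun u =>
    hf.comp (continuous_id.prodMk (hwc.smul u.continuous))
  have hrd : ∀ u v t, ‖r u t - r v t‖ ≤ ε * dist u v * w t := by
    intro u v t
    refine (hfε t _ _).trans ?_
    rw [← smul_sub, norm_smul, Real.norm_of_nonneg (hw t).le, ← dist_eq_norm]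
    calc ε * (w t * dist (u t) (v t)) ≤ ε * (w t * dist u v) := by
          gcongr
          exact BoundedContinuousFunction.dist_coe_le_dist t
      _ = _ := by ring
  have hrb : ∀ u t, ‖r u t‖ ≤ (ε * dist u 0 + ρ) * w t := by
    intro u t
    have h1 := hrd u 0 t
    have h2 : r 0 t = f t 0 := by simp [r]
    rw [h2] at h1
    rw [add_mul]
    calc ‖r u t‖ = ‖(r u t - f t 0) + f t 0‖ := by rw [sub_add_cancel]
      _ ≤ _ := norm_add_le_of_le h1 (hf0 t)
  choose R hRd hRP M hRM using fun u => H.exists_solution (r u) _ (hrc u) (hrb u) ξ hξ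
  have hRc : ∀ u, Continuous (R u) := fun u =>
    continuous_iff_continuousAt.2 fun t => (hRd u t).continuousAt
  let T : BoundedContinuousFunction ℝ E → BoundedContinuousFunction ℝ E := fun u =>
    BoundedContinuousFunction.ofNormedAddCommGroup (fun t => (w t)⁻¹ • R u t)
      ((hwc.inv₀ fun t => (hw t).ne').smul (hRc u)) (M u) (fun t => by
        rw [norm_smul, norm_inv, Real.norm_of_nonneg (hw t).le, inv_mul_le_iff₀ (hw t), mul_comm]
        exact hRM u t)
  have hT : ∀ u t, T u t = (w t)⁻¹ • R u t := fun u t => rfl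
  have hcontr : ContractingWith (1 / 2) T := by
    refine ⟨by norm_num, LipschitzWith.of_dist_le_mul fun u v => ?_⟩
    refine (BoundedContinuousFunction.dist_le (by positivity)).2 fun t => ?_
    have h1 := (H.estimate (fun t => R u t - R v t) (fun t => r u t - r v t) (ε * dist u v)
      (M u + M v) ((hrc u).sub (hrc v)) (hrd u v) (fun t => by
        have := (hRd u t).sub (hRd v t)
        rwa [add_sub_add_comm, ← map_sub] at this) (fun t => by
        rw [add_mul]
        exact (_root_.norm_sub_le _ _).trans (add_le_add (hRM u t) (hRM v t)))).2 t
    -- All the `R u` have the same center component `ξ`, so only the difference of the forcings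
    -- remains.
    rw [map_sub, hRP, hRP, sub_self, norm_zero, zero_add] at h1
    rw [hT, hT, dist_eq_norm, ← smul_sub, norm_smul, norm_inv, Real.norm_of_nonneg (hw t).le,
      inv_mul_le_iff₀ (hw t), mul_comm (w t)]
    refine h1.trans ?_
    have : K * (ε * dist u v) ≤ 1 / 2 * dist u v := by
      rw [← mul_assoc]; gcongr
    exact mul_le_mul_of_nonneg_right (by simpa using this) (hw t).le
  have hfix : T hcontr.fixedPoint = hcontr.fixedPoint := hcontr.fixedPoint_isFixedPt
  set u := hcontr.fixedPoint
  refine ⟨R u, ⟨fun t => ?_, M u, hRM u⟩, hRP u⟩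
  have h1 : w t • u t = R u t := by
    conv_lhs => rw [← hfix, hT, smul_smul, mul_inv_cancel₀ (hw t).ne', one_smul]
  have h2 := hRd u t
  simp only [r, h1] at h2
  exact h2

end Nonlinear

/-! ### Differentiability of the center map. -/

section Smoothness

variable {E : Type*} [NormedAddCommGroup E] [NormedSpace ℝ E]

theorem norm_sub_sub_fderiv_le {g : E → E} {g' : E → E →L[ℝ] E} (hg : ∀ x, HasFDerivAt g (g' x) x)
    {L : ℝ} (hL : 0 ≤ L) (hgL : ∀ x y, ‖g' x - g' y‖ ≤ L * ‖x - y‖) (x y : E) :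
    ‖g y - g x - g' x (y - x)‖ ≤ L * ‖y - x‖ ^ 2 := by
  have := (convex_segment x y).norm_image_sub_le_of_norm_hasFDerivWithin_le'
    (f := g) (φ := g' x) (C := L * ‖y - x‖) (fun z _ => (hg z).hasFDerivWithinAt) (fun z hz => by
      refine (hgL z x).trans ?_
      gcongr
      obtain ⟨a, b, ha, hb, hab, rfl⟩ := hz
      have : a • x + b • y - x = b • (y - x) := by
        have : a = 1 - b := by linarith
        rw [this]; module
      rw [this, norm_smul, Real.norm_of_nonneg hb]
      exact mul_le_of_le_one_left (norm_nonneg _) (by linarith)) (left_mem_segment ℝ x y)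
    (right_mem_segment ℝ x y)
  rwa [mul_assoc, ← pow_two] at this

/-- Two growth rates `η`, `2 * η` for which the linear equation is solvable, and a nonlinearity
`g` with small and Lipschitz derivative that vanishes to second order at the origin. -/
structure SlowData (A P : E →L[ℝ] E) (U : Submodule ℝ E) (g : E → E) (g' : E → E →L[ℝ] E)
    (η K ε L : ℝ) : Prop where
  η_nonneg : 0 ≤ η
  K_nonneg : 0 ≤ K
  ε_nonneg : 0 ≤ ε
  L_nonneg : 0 ≤ L
  small : K * ε ≤ 1 / 2
  solvable : WeightedSolvable A P U η K
  solvable_two : WeightedSolvable A P U (2 * η) K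
  proj_mem : ∀ v, P v ∈ U
  hasFDerivAt : ∀ x, HasFDerivAt g (g' x) x
  zero : g 0 = 0
  deriv_zero : g' 0 = 0
  deriv_le : ∀ x, ‖g' x‖ ≤ ε
  deriv_lipschitz : ∀ x y, ‖g' x - g' y‖ ≤ L * ‖x - y‖

namespace SlowData

variable {A P : E →L[ℝ] E} {U : Submodule ℝ E} {g : E → E} {g' : E → E →L[ℝ] E} {η K ε L : ℝ}
  (D : SlowData A P U g g' η K ε L)

include D

theorem norm_sub_le (x y : E) : ‖g x - g y‖ ≤ ε * ‖x - y‖ :=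
  Convex.norm_image_sub_le_of_norm_hasFDerivWithin_le (s := Set.univ)
    (fun z _ => (D.hasFDerivAt z).hasFDerivWithinAt) (fun z _ => D.deriv_le z) convex_univ
    trivial trivial

theorem continuous : Continuous g :=
  continuous_iff_continuousAt.2 fun x => (D.hasFDerivAt x).continuousAt

theorem continuous_deriv : Continuous g' :=
  (LipschitzWith.of_dist_le' (K := L) fun x y => by
    simpa [dist_eq_norm] using D.deriv_lipschitz x y).continuous

theorem slowSolution_unique {V W : ℝ → E} (hV : IsSlowSolution A (fun _ => g) η V)
    (hW : IsSlowSolution A (fun _ => g) η W) (h : P (V 0) = P (W 0)) : V = W :=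
  D.solvable.slowSolution_unique D.ε_nonneg D.small (f := fun _ => g)
    (D.continuous.comp continuous_snd) (fun _ => D.norm_sub_le) hV hW h

theorem norm_slowSolution_sub_le {V W : ℝ → E} (hV : IsSlowSolution A (fun _ => g) η V)
    (hW : IsSlowSolution A (fun _ => g) η W) (t : ℝ) :
    ‖V t - W t‖ ≤ 2 * K * ‖P (V 0) - P (W 0)‖ * Real.exp (η * |t|) := by
  have := D.solvable.norm_sub_le D.ε_nonneg D.small (ρ := 0) (f₁ := fun _ => g) (f₂ := fun _ => g)
    (D.continuous.comp hV.continuous) (D.continuous.comp hW.continuous) hV hW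
    (fun t => by simpa using D.norm_sub_le _ _) t
  simpa using this

theorem isSlowSolution_zero : IsSlowSolution A (fun _ => g) η 0 :=
  ⟨fun t => by simp [D.zero], 0, fun t => by simp⟩

theorem exists_slowSolution [CompleteSpace E] (ξ : U) :
    ∃ V, IsSlowSolution A (fun _ => g) η V ∧ P (V 0) = ξ :=
  D.solvable.exists_slowSolution D.ε_nonneg D.small (f := fun _ => g) (ρ := 0)
    (D.continuous.comp continuous_snd) (fun _ => D.norm_sub_le) (fun t => by simp [D.zero]) ξ.2

theorem norm_linearized_le (x z : E) : ‖g' x z‖ ≤ ε * ‖z‖ :=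
  ((g' x).le_opNorm z).trans (mul_le_mul_of_nonneg_right (D.deriv_le x) (norm_nonneg z))

theorem continuous_linearized {V : ℝ → E} (hV : Continuous V) :
    Continuous fun p : ℝ × E => g' (V p.1) p.2 :=
  (D.continuous_deriv.comp (hV.comp continuous_fst)).clm_apply continuous_snd

theorem continuous_linearized_comp {V Z : ℝ → E} (hV : Continuous V) (hZ : Continuous Z) :
    Continuous fun t => g' (V t) (Z t) :=
  (D.continuous_deriv.comp hV).clm_apply hZ

theorem exists_linearized [CompleteSpace E] {V : ℝ → E} (hV : Continuous V) (e : U) :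
    ∃ Z, IsSlowSolution A (fun t => g' (V t)) η Z ∧ P (Z 0) = e :=
  D.solvable.exists_slowSolution D.ε_nonneg D.small (f := fun t => g' (V t)) (ρ := 0)
    (D.continuous_linearized hV)
    (fun t x y => by rw [← map_sub]; exact D.norm_linearized_le _ _) (fun t => by simp) e.2

theorem linearized_unique {V Z W : ℝ → E} (hV : Continuous V)
    (hZ : IsSlowSolution A (fun t => g' (V t)) η Z) (hW : IsSlowSolution A (fun t => g' (V t)) η W)
    (h : P (Z 0) = P (W 0)) : Z = W :=
  D.solvable.slowSolution_unique D.ε_nonneg D.small (f := fun t => g' (V t))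
    (D.continuous_linearized hV) (fun t x y => by rw [← map_sub]; exact D.norm_linearized_le _ _)
    hZ hW h

theorem norm_linearized_solution_le {V Z : ℝ → E} (hV : Continuous V)
    (hZ : IsSlowSolution A (fun t => g' (V t)) η Z) (t : ℝ) :
    ‖Z t‖ ≤ 2 * K * ‖P (Z 0)‖ * Real.exp (η * |t|) := by
  have := D.solvable.norm_le_of_small D.ε_nonneg D.small (ρ := 0)
    (D.continuous_linearized_comp hV hZ.continuous) hZ.hasDerivAt hZ.growth
    (fun t => by simpa using D.norm_linearized_le _ _) t
  simpa using this

theorem growth_two {R : ℝ → E} (h : ∃ M, ∀ t, ‖R t‖ ≤ M * Real.exp (η * |t|)) :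
    ∃ M, ∀ t, ‖R t‖ ≤ M * Real.exp (2 * η * |t|) := by
  obtain ⟨M, hM⟩ := h
  have hM0 : 0 ≤ M := by simpa using (norm_nonneg _).trans (hM 0)
  refine ⟨M, fun t => (hM t).trans ?_⟩
  have := D.η_nonneg
  gcongr
  linarith

/-- First order expansion of slow solutions in their central initial value. -/
theorem norm_sub_sub_linearized_le {V W Z : ℝ → E} (hV : IsSlowSolution A (fun _ => g) η V)
    (hW : IsSlowSolution A (fun _ => g) η W) (hZ : IsSlowSolution A (fun t => g' (V t)) η Z)
    (h : P (Z 0) = P (W 0) - P (V 0)) :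
    ‖W 0 - V 0 - Z 0‖ ≤ 8 * K ^ 3 * L * ‖P (W 0) - P (V 0)‖ ^ 2 := by
  have hVc := hV.continuous
  have hWc := hW.continuous
  have hZc := hZ.continuous
  have hL := D.L_nonneg
  -- The Taylor remainder of `g` is quadratic in `W - V`, hence of growth `exp (2 η |t|)`. The
  -- center component of `W - V - Z` vanishes at time `0`, so only this remainder contributes.
  have key := D.solvable_two.norm_le_of_small D.ε_nonneg D.small
    (R := fun t => W t - V t - Z t) (r := fun t => g (W t) - g (V t) - g' (V t) (Z t))
    (ρ := L * (2 * K * ‖P (W 0) - P (V 0)‖) ^ 2)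
    (((D.continuous.comp hWc).sub (D.continuous.comp hVc)).sub
      (D.continuous_linearized_comp hVc hZc))
    (fun t => by
      have := ((hW.hasDerivAt t).sub (hV.hasDerivAt t)).sub (hZ.hasDerivAt t)
      rwa [add_sub_add_comm, add_sub_add_comm, ← map_sub, ← map_sub] at this)
    (exists_growth_sub (exists_growth_sub (D.growth_two hW.growth) (D.growth_two hV.growth))
      (D.growth_two hZ.growth))
    (fun t => by
      have h1 := norm_sub_sub_fderiv_le D.hasFDerivAt hL D.deriv_lipschitz (V t) (W t)
      have h2 := D.norm_slowSolution_sub_le hW hV t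
      have h3 : g (W t) - g (V t) - g' (V t) (Z t)
          = g' (V t) (W t - V t - Z t) + (g (W t) - g (V t) - g' (V t) (W t - V t)) := by
        rw [map_sub _ (W t - V t) (Z t)]; abel
      rw [h3]
      refine norm_add_le_of_le (D.norm_linearized_le _ _) (h1.trans ?_)
      calc L * ‖W t - V t‖ ^ 2
          ≤ L * (2 * K * ‖P (W 0) - P (V 0)‖ * Real.exp (η * |t|)) ^ 2 := by gcongr
        _ = _ := by
          rw [mul_pow, ← Real.exp_nat_mul, ← mul_assoc]
          congr 2; push_cast; ring) 0
  simp only [map_sub, h, sub_self, norm_zero, zero_add, abs_zero, mul_zero, Real.exp_zero,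
    mul_one] at key
  refine key.trans (le_of_eq (by ring))

/-- This makes the derivative of the center map Lipschitz. The forcing `(g' (W t) - g' (V t)) (Z t)`
is a product of two factors of growth `exp (η |t|)`, which again calls for the rate `2 η`. -/
theorem norm_linearized_sub_le {V W Z Y : ℝ → E} (hV : IsSlowSolution A (fun _ => g) η V)
    (hW : IsSlowSolution A (fun _ => g) η W) (hZ : IsSlowSolution A (fun t => g' (V t)) η Z)
    (hY : IsSlowSolution A (fun t => g' (W t)) η Y) (h : P (Z 0) = P (Y 0)) :
    ‖Y 0 - Z 0‖ ≤ 8 * K ^ 3 * L * ‖P (W 0) - P (V 0)‖ * ‖P (Z 0)‖ := by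
  have hVc := hV.continuous
  have hWc := hW.continuous
  have hZc := hZ.continuous
  have hYc := hY.continuous
  have hL := D.L_nonneg
  have hK := D.K_nonneg
  have key := D.solvable_two.norm_le_of_small D.ε_nonneg D.small
    (R := fun t => Y t - Z t) (r := fun t => g' (W t) (Y t) - g' (V t) (Z t))
    (ρ := L * (2 * K * ‖P (W 0) - P (V 0)‖) * (2 * K * ‖P (Z 0)‖))
    ((D.continuous_linearized_comp hWc hYc).sub (D.continuous_linearized_comp hVc hZc))
    (fun t => by
      have := (hY.hasDerivAt t).sub (hZ.hasDerivAt t)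
      rwa [add_sub_add_comm, ← map_sub] at this)
    (exists_growth_sub (D.growth_two hY.growth) (D.growth_two hZ.growth))
    (fun t => by
      have h2 := D.norm_slowSolution_sub_le hW hV t
      have h4 := D.norm_linearized_solution_le hVc hZ t
      have h3 : g' (W t) (Y t) - g' (V t) (Z t)
          = g' (W t) (Y t - Z t) + (g' (W t) - g' (V t)) (Z t) := by
        simp
      rw [h3]
      refine norm_add_le_of_le (D.norm_linearized_le _ _)
        (((g' (W t) - g' (V t)).le_opNorm (Z t)).trans ?_)
      calc ‖g' (W t) - g' (V t)‖ * ‖Z t‖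
          ≤ (L * (2 * K * ‖P (W 0) - P (V 0)‖ * Real.exp (η * |t|))) *
            (2 * K * ‖P (Z 0)‖ * Real.exp (η * |t|)) := by
            gcongr
            exact (D.deriv_lipschitz _ _).trans (by gcongr)
        _ = L * (2 * K * ‖P (W 0) - P (V 0)‖) * (2 * K * ‖P (Z 0)‖) *
            (Real.exp (η * |t|) * Real.exp (η * |t|)) := by ring
        _ = _ := by
          rw [← Real.exp_add]
          congr 2; ring) 0
  simp only [map_sub, h, sub_self, norm_zero, zero_add, abs_zero, mul_zero, Real.exp_zero,
    mul_one] at key ⊢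
  refine key.trans (le_of_eq (by ring))

/-- The global center manifold of `V' = A V + g V`, parametrized by a `C¹` right inverse of `P` on `U`. -/
theorem exists_centerMap [CompleteSpace E] :
    ∃ Φ : U → E, ContDiff ℝ 1 Φ ∧ (∀ ξ, P (Φ ξ) = ξ) ∧ Φ 0 = 0 ∧ HasFDerivAt Φ U.subtypeL 0 ∧
      (∀ ξ, ‖Φ ξ‖ ≤ 2 * K * ‖ξ‖) ∧
      (∀ ξ, ∃ V, IsSlowSolution A (fun _ => g) η V ∧ V 0 = Φ ξ) ∧
      ∀ V, IsSlowSolution A (fun _ => g) η V → ∀ t, V t = Φ ⟨P (V t), D.proj_mem _⟩ := by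
  choose V hV hVP using D.exists_slowSolution
  choose Z hZ hZP using fun ξ => D.exists_linearized (hV ξ).continuous
  -- Uniqueness for the linearized equation is what makes `Z ξ e` linear in `e`.
  have hZu : ∀ ξ (e : U) W, IsSlowSolution A (fun t => g' (V ξ t)) η W → P (W 0) = e → W = Z ξ e :=
    fun ξ e W hW h => D.linearized_unique (hV ξ).continuous hW (hZ ξ e) (h.trans (hZP ξ e).symm)
  have hadd : ∀ ξ e e', Z ξ (e + e') = Z ξ e + Z ξ e' := by
    intro ξ e e'
    refine (hZu ξ _ _ ⟨fun t => ?_, ?_⟩ ?_).symm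
    · have := ((hZ ξ e).hasDerivAt t).add ((hZ ξ e').hasDerivAt t)
      rw [add_add_add_comm, ← map_add, ← map_add] at this
      exact this
    · obtain ⟨M, hM⟩ := (hZ ξ e).growth
      obtain ⟨M', hM'⟩ := (hZ ξ e').growth
      refine ⟨M + M', fun t => ?_⟩
      rw [add_mul]
      exact norm_add_le_of_le (hM t) (hM' t)
    · simp [hZP]
  have hsmul : ∀ ξ (c : ℝ) e, Z ξ (c • e) = c • Z ξ e := by
    intro ξ c e
    refine (hZu ξ _ _ ⟨fun t => ?_, ?_⟩ ?_).symm
    · have := ((hZ ξ e).hasDerivAt t).const_smul c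
      rw [smul_add, ← map_smul, ← map_smul] at this
      exact this
    · obtain ⟨M, hM⟩ := (hZ ξ e).growth
      refine ⟨‖c‖ * M, fun t => ?_⟩
      rw [Pi.smul_apply, norm_smul, mul_assoc]
      exact mul_le_mul_of_nonneg_left (hM t) (norm_nonneg c)
    · simp [hZP]
  let Λ : U → U →L[ℝ] E := fun ξ => LinearMap.mkContinuous
    { toFun := fun e => Z ξ e 0
      map_add' := fun e e' => by rw [hadd]; rfl
      map_smul' := fun c e => by rw [hsmul]; rfl } (2 * K) (fun e => by
        have := D.norm_linearized_solution_le (hV ξ).continuous (hZ ξ e) 0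
        simpa [hZP] using this)
  have hΛ : ∀ ξ e, Λ ξ e = Z ξ e 0 := fun ξ e => rfl
  have hK := D.K_nonneg
  have hL := D.L_nonneg
  have hderiv : ∀ ξ, HasFDerivAt (fun ξ => V ξ 0) (Λ ξ) ξ := by
    intro ξ
    rw [hasFDerivAt_iff_isLittleO]
    refine Asymptotics.IsBigO.trans_isLittleO (Asymptotics.IsBigO.of_bound (8 * K ^ 3 * L)
      (Filter.Eventually.of_forall fun ζ => ?_)) (Asymptotics.isLittleO_pow_sub_sub ξ one_lt_two)
    have := D.norm_sub_sub_linearized_le (hV ξ) (hV ζ) (hZ ξ (ζ - ξ)) (by simp [hVP, hZP])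
    rw [hVP, hVP] at this
    simpa [hΛ] using this
  have hΛc : Continuous Λ := by
    refine (LipschitzWith.of_dist_le' (f := Λ) (K := 8 * K ^ 3 * L) fun ζ ξ => ?_).continuous
    rw [dist_eq_norm ζ ξ]
    refine (dist_eq_norm (Λ ζ) (Λ ξ)).trans_le ?_
    refine ContinuousLinearMap.opNorm_le_bound _ (by positivity) fun e => ?_
    have := D.norm_linearized_sub_le (hV ξ) (hV ζ) (hZ ξ e) (hZ ζ e) (by simp [hZP])
    rw [hVP, hVP, hZP] at this
    simpa [hΛ] using this
  have hV0 : V 0 = 0 := D.slowSolution_unique (hV 0) D.isSlowSolution_zero (by simp [hVP])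
  have hΛ0 : Λ 0 = U.subtypeL := by
    ext e
    obtain ⟨M, hM⟩ := (hZ 0 e).growth
    -- Along the zero solution the linearization is `R' = A R`. The first part of the estimate with
    -- `ρ = 0` says that the initial value equals its center component `e`.
    have h1 := (D.solvable.estimate (Z 0 e) 0 0 M continuous_const (fun t => by simp) (fun t => by
      have := (hZ 0 e).hasDerivAt t
      simpa [hV0, D.deriv_zero] using this) hM).1
    rw [mul_zero, hZP] at h1
    exact sub_eq_zero.1 (norm_le_zero_iff.1 h1)
  refine ⟨fun ξ => V ξ 0, ?_, fun ξ => hVP ξ, by simp [hV0], hΛ0 ▸ hderiv 0, fun ξ => ?_,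
    fun ξ => ⟨V ξ, hV ξ, rfl⟩, fun W hW t => ?_⟩
  · rw [contDiff_one_iff_fderiv]
    refine ⟨fun ξ => (hderiv ξ).differentiableAt, ?_⟩
    rwa [show fderiv ℝ (fun ξ => V ξ 0) = Λ from funext fun ξ => (hderiv ξ).fderiv]
  · have := D.norm_slowSolution_sub_le (hV ξ) D.isSlowSolution_zero 0
    simpa [hVP] using this
  -- The equation is autonomous, so `W t` is the initial value of a slow solution and uniqueness
  -- identifies it with a value of the center map.
  · have hshift : IsSlowSolution A (fun _ => g) η fun s => W (s + t) := by
      refine ⟨fun s => (hW.hasDerivAt (s + t)).comp_add_const s t, ?_⟩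
      obtain ⟨M, hM⟩ := hW.growth
      have hM0 : 0 ≤ M := by simpa using (norm_nonneg _).trans (hM 0)
      refine ⟨M * Real.exp (η * |t|), fun s => (hM _).trans ?_⟩
      rw [mul_assoc, ← Real.exp_add]
      have := D.η_nonneg
      gcongr
      rw [← mul_add, add_comm |t|]
      exact mul_le_mul_of_nonneg_left (abs_add_le s t) this
    have := D.slowSolution_unique hshift (hV ⟨P (W t), D.proj_mem _⟩) (by simp [hVP])
    simpa using congr_fun this 0

end SlowData

end Smoothness

/-! ### Cutting off the nonlinearity. -/

/-- A `C²` vector field vanishing at the origin agrees near the origin with the sum of its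
linearization and a nonlinearity whose derivative is globally small and Lipschitz. -/
theorem exists_cutoff {E : Type*} [NormedAddCommGroup E] [InnerProductSpace ℝ E]
    [FiniteDimensional ℝ E] {G : E → E} (hG : ContDiff ℝ 2 G) (hG0 : G 0 = 0) {ε : ℝ} (hε : 0 < ε) :
    ∃ (g : E → E) (g' : E → E →L[ℝ] E) (L r : ℝ), 0 ≤ L ∧ 0 < r ∧ (∀ x, HasFDerivAt g (g' x) x) ∧
      g' 0 = 0 ∧ (∀ x, ‖g' x‖ ≤ ε) ∧ (∀ x y, ‖g' x - g' y‖ ≤ L * ‖x - y‖) ∧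
      ∀ x ∈ Metric.ball (0 : E) r, fderiv ℝ G 0 x + g x = G x := by
  let χ : ContDiffBump (0 : E) := ⟨1, 2, one_pos, one_lt_two⟩
  have hχ2 : ContDiff ℝ 2 χ := χ.contDiff
  obtain ⟨B, hB⟩ := (hχ2.continuous_fderiv two_ne_zero).bounded_above_of_compact_support
    (χ.hasCompactSupport.fderiv ℝ)
  have hB0 : 0 ≤ B := (norm_nonneg _).trans (hB 0)
  let N : E → E := fun x => G x - fderiv ℝ G 0 x
  have hN2 : ContDiff ℝ 2 N := hG.sub (fderiv ℝ G 0).contDiff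
  have hN' : ∀ x, HasFDerivAt N (fderiv ℝ N x) x := fun x =>
    (hN2.differentiable two_ne_zero x).hasFDerivAt
  have hN0 : N 0 = 0 := by simp [N, hG0]
  have hDN0 : fderiv ℝ N 0 = 0 := by
    have h := (hG.differentiable two_ne_zero 0).hasFDerivAt.sub (fderiv ℝ G 0).hasFDerivAt
    rw [sub_self] at h
    exact h.fderiv
  -- On the ball of radius `2 δ`, `χ • N'` contributes at most `ε'`, and the term with the
  -- derivative of the cutoff at most `(B / δ) * (ε' * 2 δ)`: in all `ε' * (1 + 2 * B)`, whatever
  -- `δ` is.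
  set ε' := ε / (1 + 2 * B) with hε'
  have hε'0 : 0 < ε' := by positivity
  obtain ⟨s, hs, hsN⟩ := Metric.continuousAt_iff.1
    (hN2.continuous_fderiv two_ne_zero).continuousAt ε' hε'0
  have hDN : ∀ x ∈ Metric.ball (0 : E) s, ‖fderiv ℝ N x‖ ≤ ε' := fun x hx => by
    have := hsN hx
    rw [hDN0, dist_zero_right] at this
    exact this.le
  have hNx : ∀ x ∈ Metric.ball (0 : E) s, ‖N x‖ ≤ ε' * ‖x‖ := fun x hx => by
    have := (convex_ball (0 : E) s).norm_image_sub_le_of_norm_hasFDerivWithin_le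
      (fun z _ => (hN' z).hasFDerivWithinAt) hDN (Metric.mem_ball_self hs) hx
    simpa [hN0] using this
  -- This puts the ball of radius `2 δ`, outside which the cutoff vanishes, inside the ball of
  -- radius `s` where `N` is controlled.
  set δ := s / 3 with hδ
  have hδ0 : 0 < δ := by positivity
  let g : E → E := fun x => χ (δ⁻¹ • x) • N x
  have hg2 : ContDiff ℝ 2 g := (hχ2.comp (contDiff_const_smul δ⁻¹)).smul hN2
  have hnorm : ∀ x : E, ‖δ⁻¹ • x‖ = δ⁻¹ * ‖x‖ := fun x => by
    rw [norm_smul, norm_inv, Real.norm_of_nonneg hδ0.le]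
  have hgout : ∀ x : E, 2 * δ ≤ ‖x‖ → g x = 0 := fun x hx => by
    have : χ (δ⁻¹ • x) = 0 := χ.zero_of_le_dist (by
      rw [dist_zero_right, hnorm, le_inv_mul_iff₀ hδ0]
      change δ * 2 ≤ _
      linarith)
    simp [g, this]
  have hgin : ∀ x ∈ Metric.ball (0 : E) δ, g x = N x := fun x hx => by
    have : χ (δ⁻¹ • x) = 1 := χ.one_of_mem_closedBall (by
      rw [mem_closedBall_zero_iff, hnorm, inv_mul_le_iff₀ hδ0]
      change _ ≤ δ * 1
      rw [mem_ball_zero_iff] at hx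
      linarith)
    simp [g, this]
  have hgd : ∀ x, HasFDerivAt g (fderiv ℝ g x) x := fun x =>
    (hg2.differentiable two_ne_zero x).hasFDerivAt
  have hgs : HasCompactSupport g := HasCompactSupport.intro
    (isCompact_closedBall (0 : E) (2 * δ)) fun x hx => hgout x (by
      rw [mem_closedBall_zero_iff, not_le] at hx; exact hx.le)
  -- The derivative of `g` is `C¹` with compact support, hence globally Lipschitz.
  obtain ⟨L, hL⟩ := ContDiff.lipschitzWith_of_hasCompactSupport (𝕂 := ℝ) (n := 1) (hgs.fderiv ℝ)
    (hg2.fderiv_right (by norm_num)) one_ne_zero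
  refine ⟨g, fderiv ℝ g, L, δ, L.2, hδ0, hgd, ?_, fun x => ?_, fun x y => ?_, fun x hx => ?_⟩
  · rw [← hDN0]
    refine Filter.EventuallyEq.fderiv_eq ?_
    filter_upwards [Metric.ball_mem_nhds (0 : E) hδ0] with x hx using hgin x hx
  · rcases le_or_gt ‖x‖ (2 * δ) with hx | hx
    · have hxs : x ∈ Metric.ball (0 : E) s := by
        rw [mem_ball_zero_iff]; linarith
      have h1 : HasFDerivAt (fun x => χ (δ⁻¹ • x))
          ((fderiv ℝ χ (δ⁻¹ • x)) ∘L (δ⁻¹ • ContinuousLinearMap.id ℝ E)) x :=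
        (hχ2.differentiable two_ne_zero _).hasFDerivAt.comp x
          ((hasFDerivAt_id x).const_smul δ⁻¹)
      rw [show fderiv ℝ g x = _ from (h1.smul (hN' x)).fderiv]
      have h2 : ‖(fderiv ℝ χ (δ⁻¹ • x)) ∘L (δ⁻¹ • ContinuousLinearMap.id ℝ E)‖ ≤ B * δ⁻¹ := by
        refine (ContinuousLinearMap.opNorm_comp_le _ _).trans ?_
        gcongr
        · exact hB _
        · rw [norm_smul, norm_inv, Real.norm_of_nonneg hδ0.le]
          exact mul_le_of_le_one_right (by positivity) ContinuousLinearMap.norm_id_le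
      refine (norm_add_le _ _).trans ?_
      rw [norm_smul, ContinuousLinearMap.norm_smulRight_apply, Real.norm_of_nonneg χ.nonneg]
      calc _ ≤ 1 * ε' + B * δ⁻¹ * (ε' * (2 * δ)) := by
            gcongr
            · exact χ.le_one
            · exact hDN x hxs
            · exact (hNx x hxs).trans (by gcongr)
        _ = ε' * (1 + 2 * B) := by field_simp
        _ = ε := by rw [hε']; field_simp
        _ ≤ ε := le_rfl
    · have : fderiv ℝ g x = fderiv ℝ (fun _ => (0 : E)) x := by
        refine Filter.EventuallyEq.fderiv_eq ?_
        filter_upwards [(isOpen_lt continuous_const continuous_norm).mem_nhds hx] with y hy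
        exact hgout y (le_of_lt hy)
      rw [this]
      simp [hε.le]
  · simpa [dist_eq_norm] using hL.dist_le_mul x y
  · rw [hgin x hx]
    simp [N]

theorem WeightedSolvable.mono {E : Type*} [NormedAddCommGroup E] [NormedSpace ℝ E]
    {A P : E →L[ℝ] E} {U : Submodule ℝ E} {κ K K' : ℝ} (H : WeightedSolvable A P U κ K)
    (h : K ≤ K') : WeightedSolvable A P U κ K' := by
  refine ⟨H.exists_solution, fun R r ρ M hr hrb hR hM => ?_⟩
  have hρ : 0 ≤ ρ := by simpa using (norm_nonneg _).trans (hrb 0)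
  obtain ⟨h1, h2⟩ := H.estimate R r ρ M hr hrb hR hM
  exact ⟨h1.trans (by gcongr), fun t => (h2 t).trans (by gcongr)⟩

/-! ### The local center manifold of `G`. -/

theorem fderiv_apply_eq_sum_jacobianMatrix {d : ℕ}
    (G : EuclideanSpace ℝ (Fin d) → EuclideanSpace ℝ (Fin d)) (x v : EuclideanSpace ℝ (Fin d))
    (i : Fin d) : fderiv ℝ G x v i = ∑ j, jacobianMatrix G x i j * v j := by
  have h : v = ∑ j, v j • EuclideanSpace.single j (1 : ℝ) := by
    ext k
    simp [Pi.single_apply]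
  conv_lhs => rw [h]
  simp [jacobianMatrix, mul_comm]

theorem theorem3p1 (d : ℕ) (G : EuclideanSpace ℝ (Fin d) → EuclideanSpace ℝ (Fin d))
    (hG : ContDiff ℝ 2 G) (hG0 : G 0 = 0)
    (hc : centerSubspace (jacobianMatrix G 0) ≠ ⊥) :
    ∃ δ : ℝ, 0 < δ ∧
      ∃ (M : Set (EuclideanSpace ℝ (Fin d)))
        (φ : centerSubspace (jacobianMatrix G 0) → EuclideanSpace ℝ (Fin d)),
        IsC1Parametrization (centerSubspace (jacobianMatrix G 0)) δ φ M ∧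
        IsTangentAtOrigin (centerSubspace (jacobianMatrix G 0)) φ ∧
        IsLocallyInvariant G M ∧
        ∀ V : ℝ → EuclideanSpace ℝ (Fin d),
          IsIntegralCurve V (fun _ => G) →
          (∀ t : ℝ, V t ∈ Metric.ball (0 : EuclideanSpace ℝ (Fin d)) δ) →
          ∀ t : ℝ, V t ∈ M := by
  set U := centerSubspace (jacobianMatrix G 0)
  set A := fderiv ℝ G 0
  obtain ⟨S⟩ := nonempty_centerSplitting (jacobianMatrix G 0)
    (fderiv_apply_eq_sum_jacobianMatrix G 0)
  have hβ := S.β_pos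
  -- Both `η` and `2 * η` are then below `β`.
  set η := S.β / 4 with hη
  have hη0 : 0 < η := by positivity
  obtain ⟨K₁, hK₁, H₁⟩ := S.exists_weightedSolvable hη0 (by linarith)
  obtain ⟨K₂, hK₂, H₂⟩ := S.exists_weightedSolvable (κ := 2 * η) (by positivity) (by linarith)
  set K := max K₁ K₂
  have hK : 0 ≤ K := hK₁.trans (le_max_left _ _)
  -- `K` depends only on the linear part, so the cutoff can be chosen afterwards with `K * ε ≤ 1 /
  -- 2`.
  obtain ⟨g, g', L, r, hL, hr, hg, hg'0, hg'ε, hg'L, hgG⟩ := exists_cutoff hG hG0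
    (ε := 1 / (2 * (K + 1))) (by positivity)
  have D : SlowData A S.Pc U g g' η K (1 / (2 * (K + 1))) L :=
    { η_nonneg := hη0.le
      K_nonneg := hK
      ε_nonneg := by positivity
      L_nonneg := hL
      small := by
        rw [mul_one_div, div_le_div_iff₀ (by positivity) (by positivity)]
        linarith
      solvable := H₁.mono (le_max_left _ _)
      solvable_two := H₂.mono (le_max_right _ _)
      proj_mem := S.center_mem
      hasFDerivAt := hg
      zero := by simpa [hG0] using hgG 0 (Metric.mem_ball_self hr)
      deriv_zero := hg'0
      deriv_le := hg'ε
      deriv_lipschitz := hg'L }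
  obtain ⟨Φ, hΦ, hPΦ, hΦ0, hΦ'0, hΦb, hΦex, hΦinv⟩ := D.exists_centerMap
  set Q : EuclideanSpace ℝ (Fin d) →L[ℝ] U := S.Pc.codRestrict U S.center_mem
  have hQΦ : ∀ ξ, Q (Φ ξ) = ξ := fun ξ => Subtype.ext (hPΦ ξ)
  have hQn : ∀ x, ‖Q x‖ ≤ ‖S.Pc‖ * ‖x‖ := fun x => S.Pc.le_opNorm x
  -- The scaling by `p` makes up for the projection not being orthogonal.
  set p := ‖S.Pc‖ + 1 with hp
  have hp0 : 0 < p := by positivity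
  -- As `‖Φ ξ‖ ≤ 2 * K * ‖ξ‖`, the map `Φ` sends the ball of radius `p * δ` into the ball of radius
  -- `r`, where `A + g = G`. The summand `1` makes this strict and gives `δ ≤ r`.
  set δ := r / (2 * K * p + 1) with hδ
  have hδ0 : 0 < δ := by positivity
  have hδr : (2 * K * p + 1) * δ = r := by rw [hδ]; field_simp
  have hδr' : δ ≤ r := by
    have : 0 ≤ 2 * K * p * δ := by positivity
    linarith
  have hfield : ∀ {V : ℝ → EuclideanSpace ℝ (Fin d)} {t : ℝ}, V t ∈ Metric.ball 0 r →
      A (V t) + g (V t) = G (V t) := fun h => hgG _ h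
  set φ : U → EuclideanSpace ℝ (Fin d) := fun ξ => Φ (p • ξ)
  have hφ : ContDiff ℝ 1 φ := hΦ.comp (contDiff_const_smul p)
  have hQφ : ∀ ξ, Q (φ ξ) = p • ξ := fun ξ => hQΦ _
  have hmem : ∀ ξ : U, ‖ξ‖ < p * δ → Φ ξ ∈ φ '' Metric.ball 0 δ := by
    intro ξ hξ
    refine ⟨p⁻¹ • ξ, ?_, ?_⟩
    · rw [mem_ball_zero_iff, norm_smul, norm_inv, Real.norm_of_nonneg hp0.le,
        inv_mul_lt_iff₀ hp0]
      exact hξ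
    · simp only [φ, smul_smul, mul_inv_cancel₀ hp0.ne', one_smul]
  refine ⟨δ, hδ0, φ '' Metric.ball 0 δ, φ, ⟨rfl, hφ.contDiffOn, fun ξ _ => ?_, ?_⟩, ⟨?_, ?_⟩, ?_, ?_⟩
  -- `Q ∘ φ` is multiplication by `p`, so `φ` has a continuous linear left inverse: this yields both
  -- the immersion and the embedding property.
  · have h1 : HasFDerivAt (fun ξ => Q (φ ξ)) (Q ∘L fderiv ℝ φ ξ) ξ :=
      Q.hasFDerivAt.comp ξ (hφ.differentiable one_ne_zero ξ).hasFDerivAt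
    simp only [hQφ] at h1
    have h2 := h1.unique ((hasFDerivAt_id ξ).const_smul p)
    intro a b hab
    have h3 : ∀ c, Q (fderiv ℝ φ ξ c) = p • c := fun c => DFunLike.congr_fun h2 c
    have h4 : p • a = p • b := by rw [← h3, ← h3, hab]
    exact smul_right_injective _ hp0.ne' h4
  · have h1 : Function.LeftInverse (fun x => p⁻¹ • Q x) φ := fun ξ => by
      change p⁻¹ • Q (φ ξ) = ξ
      rw [hQφ, smul_smul, inv_mul_cancel₀ hp0.ne', one_smul]
    exact (h1.isEmbedding (Q.continuous.const_smul p⁻¹) hφ.continuous).comp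
      IsEmbedding.subtypeVal
  · simp [φ, hΦ0]
  · have h1 : HasFDerivAt φ (U.subtypeL ∘L (p • ContinuousLinearMap.id ℝ U)) 0 :=
      HasFDerivAt.comp (0 : U) (by simpa using hΦ'0) ((hasFDerivAt_id (0 : U)).const_smul p)
    rw [h1.fderiv]
    ext x
    constructor
    · rintro ⟨ξ, rfl⟩
      exact (p • ξ).2
    · intro hx
      refine ⟨p⁻¹ • ⟨x, hx⟩, ?_⟩
      simp [smul_smul, mul_inv_cancel₀ hp0.ne']
  · rintro _ ⟨ξ, hξ, rfl⟩
    rw [mem_ball_zero_iff] at hξ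
    have hpξ : ‖p • ξ‖ < p * δ := by
      rw [norm_smul, Real.norm_of_nonneg hp0.le]
      gcongr
    obtain ⟨W, hW, hW0⟩ := hΦex (p • ξ)
    have hWr : ∀ᶠ t in 𝓝 (0 : ℝ), W t ∈ Metric.ball 0 r := by
      refine hW.continuous.continuousAt.eventually_mem (Metric.isOpen_ball.mem_nhds ?_)
      rw [hW0, mem_ball_zero_iff]
      calc ‖Φ (p • ξ)‖ ≤ 2 * K * ‖p • ξ‖ := hΦb _
        _ ≤ 2 * K * (p * δ) := by gcongr
        _ < r := by linarith
    refine ⟨⟨W, hW0, ?_⟩, ?_⟩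
    · filter_upwards [hWr] with t ht
      rw [← hfield ht]
      exact hW.hasDerivAt t
    · rintro V ⟨hV0, hV⟩
      have hVr : ∀ᶠ t in 𝓝 (0 : ℝ), V t ∈ Metric.ball 0 r := by
        refine hV.continuousAt.eventually_mem (Metric.isOpen_ball.mem_nhds ?_)
        rw [hV0, show φ ξ = W 0 from hW0.symm]
        exact hWr.self_of_nhds
      have hlip : LipschitzWith (‖A‖₊ + Real.toNNReal (1 / (2 * (K + 1)))) fun x => A x + g x :=
        A.lipschitz.add (LipschitzWith.of_dist_le' fun x y => by
          simpa only [dist_eq_norm] using D.norm_sub_le x y)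
      -- As long as `V` stays in the ball of radius `r` it also solves the cut-off equation, whose
      -- field is globally Lipschitz, so it agrees with `W` near `0`.
      have hVW : V =ᶠ[𝓝 0] W := by
        refine ODE_solution_unique_of_eventually (v := fun _ x => A x + g x)
          (s := fun _ => Set.univ) (Filter.Eventually.of_forall fun _ => hlip.lipschitzOnWith)
          ?_ (Filter.Eventually.of_forall fun t => ⟨hW.hasDerivAt t, trivial⟩)
          (hV0.trans hW0.symm)
        filter_upwards [hV, hVr] with t ht htr
        refine ⟨?_, trivial⟩
        rw [hfield htr]
        exact ht
      have hQW : ∀ᶠ t in 𝓝 (0 : ℝ), ‖Q (W t)‖ < p * δ := by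
        refine (Q.continuous.comp hW.continuous).norm.continuousAt.eventually_lt
          continuousAt_const ?_
        simpa [hW0, hQΦ] using hpξ
      obtain ⟨e, he, h⟩ := Metric.eventually_nhds_iff.1 (hVW.and hQW)
      refine ⟨e, he, fun t ht => ?_⟩
      obtain ⟨h1, h2⟩ := h (y := t) (by simpa using ht)
      rw [h1, hΦinv W hW t]
      exact hmem _ h2
  · intro V hV hVδ t
    -- A solution confined to the ball of radius `δ ≤ r` solves the cut-off equation and, being
    -- bounded, is slow.
    have hslow : IsSlowSolution A (fun _ => g) η V := by
      refine ⟨fun t => ?_, δ, fun t => ?_⟩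
      · rw [hfield (Metric.ball_subset_ball hδr' (hVδ t))]
        exact hV t
      · have h1 := (mem_ball_zero_iff.1 (hVδ t)).le
        exact h1.trans (le_mul_of_one_le_right hδ0.le (Real.one_le_exp (by positivity)))
    rw [hΦinv V hslow t]
    refine hmem _ ((hQn (V t)).trans_lt ?_)
    have h1 := mem_ball_zero_iff.1 (hVδ t)
    calc ‖S.Pc‖ * ‖V t‖ ≤ ‖S.Pc‖ * δ := by gcongr
      _ < p * δ := by rw [hp]; linarith
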